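/- Let $\Gamma=(V,E)$ be a connected simple graph that is uniform, i.e. for some $\mu\in\mathbb N$ every vertex has at most $\mu$ neighbours. Regard $\Gamma$ as a geodesic metric space with its path metric $d_\Gamma$, each edge being isometric to $[0,1]$ (so the points of $\Gamma$ are the vertices and the interior points of the edges). With the Gromov product $(x|y)_o=\frac12\big(d_\Gamma(x,o)+d_\Gamma(y,o)-d_\Gamma(x,y)\big)$, assume that $\Gamma$ is Gromov hyperbolic: there is $\delta\ge 0$ such that $(x|y)_o\ge\min\{(x|z)_o,(z|y)_o\}-\delta$ for all points $o,x,y,z$ of $\Gamma$. Let $$h(\Gamma)=\inf_A\frac{|\partial A|}{|A|},\qquad \partial A=\{v\in V : d_\Gamma(v,A)=1\},$$ where $A$ ranges over all non-empty finite subsets of $V$. Then $h(\Gamma)>0$ if and only if the following three conditions hold: 1. $\Gamma$ is infinite (that is, $V$ is infinite); 2. $\Gamma$ has a pole: there are a point $v$ of $\Gamma$ and $M>0$ such that every point of $\Gamma$ lies in the $M$-neighbourhood of some geodesic ray emanating from $v$; 3. there is a visual metric $d$ on the boundary at infinity $\partial_\infty\Gamma$ such that $(\partial_\infty\Gamma,d)$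 is uniformly perfect. Here $\partial_\infty\Gamma$ is the set of sequences $(x_i)$ of points of $\Gamma$ with $\lim_{i,j\to\infty}(x_i|x_j)_o=\infty$, modulo the equivalence relation $(x_i)\sim(x_i')$ iff $\lim_{i\to\infty}(x_i|x_i')_o=\infty$ (these notions do not depend on $o$). For $\xi,\xi'\in\partial_\infty\Gamma$ put $(\xi|\xi')_o=\inf\liminf_{i\to\infty}(x_i|x_i')_o\in[0,\infty]$, the infimum being over all $(x_i)\in\xi$, $(x_i')\in\xi'$. A metric $d$ on $\partial_\infty\Gamma$ is visual if there are a point $o$ of $\Gamma$, $a>1$ and $c_1,c_2>0$ with $c_1a^{-(\xi|\xi')_o}\le d(\xi,\xi')\le c_2a^{-(\xi|\xi')_o}$ for all $\xi,\xi'\in\partial_\infty\Gamma$ (where $a^{-\infty}=0$). A metric space $(Y,d)$ is uniformly perfect if there are $S>1$ and $\varepsilon_0>0$ such that for every $x\in Y$ and every $0<\varepsilon\le\varepsilon_0$ there is $y\in Y$ with $\varepsilon/S<d(x,y)\le\varepsilon$. -/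

import Mathlib

open Filter Set
open scoped ENNReal NNReal

/-! ### Graphs -/

/-- A graph is uniform if the number of neighbours of its vertices is bounded. -/
def IsUniformGraph {V : Type*} (G : SimpleGraph V) : Prop :=
  ∃ μ : ℕ, ∀ v : V, (G.neighborSet v).encard ≤ μ

/-- The (outer) vertex boundary `{v | d(v, A) = 1}` of a set of vertices. -/
def vertexBoundary {V : Type*} (G : SimpleGraph V) (A : Set V) : Set V :=
  {v | (⨅ a ∈ A, G.edist v a) = 1}

/-- The combinatorial Cheeger isoperimetric constant `inf_A |∂A| / |A|`, the infimum being over all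
nonempty finite sets of vertices. -/
noncomputable def cheegerConstant {V : Type*} (G : SimpleGraph V) : ℝ≥0∞ :=
  ⨅ (A : Finset V) (_ : A.Nonempty),
    ((vertexBoundary G (A : Set V)).encard : ℝ≥0∞) / (A.card : ℝ≥0∞)

/-! ### The metric graph: every edge is a copy of `[0, 1]` -/

/-- A representative of a point of the metric graph of a connected graph `G`: either the point of
the edge joining `src` to `tgt` at distance `pos ∈ [0, 1]` from `src`, or (when `src = tgt` and
`pos = 0`) the vertex `src`. A point may have several representatives. -/
structure MetricGraphRep {V : Type*} (G : SimpleGraph V) (hG : G.Connected) where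
  src : V
  tgt : V
  pos : ℝ
  pos_nonneg : 0 ≤ pos
  pos_le_one : pos ≤ 1
  valid : G.Adj src tgt ∨ (src = tgt ∧ pos = 0)

namespace MetricGraphRep

variable {V : Type*} {G : SimpleGraph V} {hG : G.Connected}

/-- The two endpoints of the edge. -/
def vert (p : MetricGraphRep G hG) : Bool → V
  | false => p.src
  | true => p.tgt

/-- The length of the part of the edge from the point to each of the two endpoints. -/
def off (p : MetricGraphRep G hG) : Bool → ℝ
  | false => p.pos
  | true => 1 - p.pos

open Classical in
/-- The path distance: two points of one edge are joined along that edge, and a shortest path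
between points of different edges leaves the first edge through one of its endpoints and enters the
second one through one of its endpoints. -/
noncomputable def pathDist (p q : MetricGraphRep G hG) : ℝ :=
  if p.src = q.src ∧ p.tgt = q.tgt then |p.pos - q.pos|
  else if p.src = q.tgt ∧ p.tgt = q.src then |p.pos - (1 - q.pos)|
  else ⨅ ij : Bool × Bool,
    (p.off ij.1 + (G.dist (p.vert ij.1) (q.vert ij.2) : ℝ) + q.off ij.2)

theorem off_nonneg (p : MetricGraphRep G hG) (i : Bool) : 0 ≤ p.off i := by
  have h0 := p.pos_nonneg
  have h1 := p.pos_le_one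
  cases i <;> simp only [off] <;> linarith

theorem dist_vert_le (p : MetricGraphRep G hG) (i j : Bool) (h : i ≠ j) :
    (G.dist (p.vert i) (p.vert j) : ℝ) ≤ p.off i + p.off j := by
  have key : ∀ u v : V, (G.Adj u v ∨ u = v) → (G.dist u v : ℝ) ≤ 1 := by
    rintro u v (h | rfl)
    · rw [SimpleGraph.dist_eq_one_iff_adj.2 h]; simp
    · simp
  have hv : G.Adj p.src p.tgt ∨ p.src = p.tgt := p.valid.imp_right And.left
  cases i <;> cases j <;> simp only [vert, off] at * <;> try contradiction
  · linarith [key _ _ hv]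
  · linarith [key _ _ (hv.imp SimpleGraph.Adj.symm Eq.symm)]

theorem through_bddBelow (p q : MetricGraphRep G hG) :
    BddBelow (range fun ij : Bool × Bool =>
      (p.off ij.1 + (G.dist (p.vert ij.1) (q.vert ij.2) : ℝ) + q.off ij.2)) :=
  (finite_range _).bddBelow

theorem pathDist_cases (p q : MetricGraphRep G hG) :
    (p.src = q.src ∧ p.tgt = q.tgt ∧ p.pathDist q = |p.pos - q.pos|) ∨
    (p.src = q.tgt ∧ p.tgt = q.src ∧ p.pathDist q = |p.pos - (1 - q.pos)|) ∨
    ∃ i j, p.pathDist q = p.off i + (G.dist (p.vert i) (q.vert j) : ℝ) + q.off j := by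
  by_cases h1 : p.src = q.src ∧ p.tgt = q.tgt
  · exact Or.inl ⟨h1.1, h1.2, if_pos h1⟩
  by_cases h2 : p.src = q.tgt ∧ p.tgt = q.src
  · exact Or.inr (Or.inl ⟨h2.1, h2.2, by rw [pathDist, if_neg h1, if_pos h2]⟩)
  refine Or.inr (Or.inr ?_)
  obtain ⟨ij, hij⟩ := exists_eq_ciInf_of_finite (f := fun ij : Bool × Bool =>
      (p.off ij.1 + (G.dist (p.vert ij.1) (q.vert ij.2) : ℝ) + q.off ij.2))
  exact ⟨ij.1, ij.2, by rw [pathDist, if_neg h1, if_neg h2]; exact hij.symm⟩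

theorem pathDist_nonneg (p q : MetricGraphRep G hG) : 0 ≤ p.pathDist q := by
  rcases pathDist_cases p q with ⟨-, -, h⟩ | ⟨-, -, h⟩ | ⟨i, j, h⟩
  · rw [h]; exact abs_nonneg _
  · rw [h]; exact abs_nonneg _
  · rw [h]
    have := p.off_nonneg i
    have := q.off_nonneg j
    positivity

theorem pathDist_le_through (p q : MetricGraphRep G hG) (i j : Bool) :
    p.pathDist q ≤ p.off i + (G.dist (p.vert i) (q.vert j) : ℝ) + q.off j := by
  have hp0 := p.pos_nonneg
  have hp1 := p.pos_le_one
  have hq0 := q.pos_nonneg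
  have hq1 := q.pos_le_one
  have hd : (0 : ℝ) ≤ (G.dist (p.vert i) (q.vert j) : ℝ) := Nat.cast_nonneg _
  by_cases h1 : p.src = q.src ∧ p.tgt = q.tgt
  · rw [pathDist, if_pos h1]
    rcases q.valid with ha | ⟨he, hz⟩
    · have e1 : (G.dist q.src q.tgt : ℝ) = 1 := by
        rw [SimpleGraph.dist_eq_one_iff_adj.2 ha]; simp
      have e2 : (G.dist q.tgt q.src : ℝ) = 1 := by
        rw [SimpleGraph.dist_eq_one_iff_adj.2 ha.symm]; simp
      cases i <;> cases j <;> simp only [vert, off, h1.1, h1.2, e1, e2] at * <;>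
        rw [abs_le] <;> constructor <;> linarith
    · have hz' : p.pos = 0 := by
        rcases p.valid with hb | ⟨-, hb⟩
        · exact absurd (by rw [h1.1, h1.2, he]) hb.ne
        · exact hb
      have := p.off_nonneg i
      have := q.off_nonneg j
      rw [hz, hz']; simp only [sub_self, abs_zero]; positivity
  by_cases h2 : p.src = q.tgt ∧ p.tgt = q.src
  · rw [pathDist, if_neg h1, if_pos h2]
    rcases q.valid with ha | ⟨he, hz⟩
    · have e1 : (G.dist q.src q.tgt : ℝ) = 1 := by
        rw [SimpleGraph.dist_eq_one_iff_adj.2 ha]; simp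
      have e2 : (G.dist q.tgt q.src : ℝ) = 1 := by
        rw [SimpleGraph.dist_eq_one_iff_adj.2 ha.symm]; simp
      cases i <;> cases j <;> simp only [vert, off, h2.1, h2.2, e1, e2] at * <;>
        rw [abs_le] <;> constructor <;> linarith
    · exact absurd ⟨by rw [h2.1, he], by rw [h2.2, he]⟩ h1
  · rw [pathDist, if_neg h1, if_neg h2]
    exact ciInf_le (through_bddBelow p q) (i, j)

theorem pathDist_self (p : MetricGraphRep G hG) : p.pathDist p = 0 := by
  simp [pathDist]

theorem pathDist_comm_le (p q : MetricGraphRep G hG) : p.pathDist q ≤ q.pathDist p := by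
  rcases pathDist_cases q p with ⟨h1, h2, h⟩ | ⟨h1, h2, h⟩ | ⟨i, j, h⟩
  · rw [h, pathDist, if_pos ⟨h1.symm, h2.symm⟩, abs_sub_comm]
  · rw [h, pathDist]
    split_ifs with h3 h4
    · have hq : q.src = q.tgt := h1.trans h3.2
      have hz : q.pos = 0 := by
        rcases q.valid with hb | ⟨-, hb⟩
        · exact absurd hq hb.ne
        · exact hb
      have hz' : p.pos = 0 := by
        rcases p.valid with hb | ⟨-, hb⟩
        · exact absurd (h3.1.trans h1 ) hb.ne
        · exact hb
      simp [hz, hz']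
    · rw [show p.pos - (1 - q.pos) = q.pos - (1 - p.pos) by ring]
    · exact absurd ⟨h2.symm, h1.symm⟩ h4
  · rw [h]
    have := pathDist_le_through p q j i
    rw [SimpleGraph.dist_comm] at this
    linarith

/-- Moving along an edge changes the distance to each endpoint by at most the distance moved. -/
theorem along_off {p q : MetricGraphRep G hG}
    (h : (p.src = q.src ∧ p.tgt = q.tgt ∧ p.pathDist q = |p.pos - q.pos|) ∨
      (p.src = q.tgt ∧ p.tgt = q.src ∧ p.pathDist q = |p.pos - (1 - q.pos)|)) (j : Bool) :
    ∃ i, p.vert i = q.vert j ∧ p.off i ≤ p.pathDist q + q.off j := by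
  rcases h with ⟨h1, h2, h⟩ | ⟨h1, h2, h⟩
  · have a1 := le_abs_self (p.pos - q.pos)
    have a2 := neg_abs_le (p.pos - q.pos)
    refine ⟨j, ?_, ?_⟩ <;> cases j <;> simp only [vert, off, h1, h2, h] <;> linarith
  · have a1 := le_abs_self (p.pos - (1 - q.pos))
    have a2 := neg_abs_le (p.pos - (1 - q.pos))
    refine ⟨!j, ?_, ?_⟩ <;> cases j <;>
      simp only [vert, off, h1, h2, h, Bool.not_true, Bool.not_false] <;> linarith

theorem pathDist_comm (p q : MetricGraphRep G hG) : p.pathDist q = q.pathDist p :=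
  le_antisymm (pathDist_comm_le p q) (pathDist_comm_le q p)

theorem triangle_along_through {p q r : MetricGraphRep G hG}
    (h : (p.src = q.src ∧ p.tgt = q.tgt ∧ p.pathDist q = |p.pos - q.pos|) ∨
      (p.src = q.tgt ∧ p.tgt = q.src ∧ p.pathDist q = |p.pos - (1 - q.pos)|))
    {j k : Bool} (h' : q.pathDist r = q.off j + (G.dist (q.vert j) (r.vert k) : ℝ) + r.off k) :
    p.pathDist r ≤ p.pathDist q + q.pathDist r := by
  obtain ⟨i, hi, ho⟩ := along_off h j
  have := pathDist_le_through p r i k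
  rw [hi] at this
  linarith

theorem pathDist_triangle (p q r : MetricGraphRep G hG) :
    p.pathDist r ≤ p.pathDist q + q.pathDist r := by
  rcases or_assoc.2 (pathDist_cases p q) with h | ⟨i, j, h⟩ <;>
    rcases or_assoc.2 (pathDist_cases q r) with h' | ⟨j', k, h'⟩
  · rcases h with ⟨h1, h2, h⟩ | ⟨h1, h2, h⟩ <;> rcases h' with ⟨h1', h2', h'⟩ | ⟨h1', h2', h'⟩
    · rw [h, h', pathDist, if_pos ⟨h1.trans h1', h2.trans h2'⟩]
      exact abs_sub_le _ _ _
    · rw [h, h', pathDist]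
      split_ifs with h3 h4
      · rw [abs_le]
        have hq : p.src = p.tgt := by rw [h3.1, h2, h2']
        have hz : p.pos = 0 := by
          rcases p.valid with hb | ⟨-, hb⟩
          · exact absurd hq hb.ne
          · exact hb
        have hz' : r.pos = 0 := by
          rcases r.valid with hb | ⟨-, hb⟩
          · exact absurd (by rw [← h3.1, ← h3.2, hq]) hb.ne
          · exact hb
        rw [hz, hz']
        have := abs_nonneg (0 - q.pos)
        have := abs_nonneg (q.pos - (1 - 0))
        constructor <;> linarith
      · exact abs_sub_le _ _ _
      · exact absurd ⟨h1.trans h1', h2.trans h2'⟩ h4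
    · rw [h, h', pathDist]
      have e : |q.pos - r.pos| = |(1 - q.pos) - (1 - r.pos)| := by
        rw [abs_sub_comm]; congr 1; ring
      split_ifs with h3 h4
      · have hq : p.src = p.tgt := by rw [h3.1, h2, h1']
        have hz : p.pos = 0 := by
          rcases p.valid with hb | ⟨-, hb⟩
          · exact absurd hq hb.ne
          · exact hb
        have hz' : r.pos = 0 := by
          rcases r.valid with hb | ⟨-, hb⟩
          · exact absurd (by rw [← h3.1, ← h3.2, hq]) hb.ne
          · exact hb
        rw [hz, hz']
        have := abs_nonneg (0 - (1 - q.pos))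
        have := abs_nonneg (q.pos - 0)
        simp only [sub_self, abs_zero]; linarith
      · rw [e]; exact abs_sub_le _ _ _
      · exact absurd ⟨h1.trans h2', h2.trans h1'⟩ h4
    · rw [h, h', pathDist, if_pos ⟨h1.trans h2', h2.trans h1'⟩]
      have e : |q.pos - (1 - r.pos)| = |(1 - q.pos) - r.pos| := by
        rw [abs_sub_comm]; congr 1; ring
      rw [e]; exact abs_sub_le _ _ _
  · exact triangle_along_through h h'
  · have h'' : (r.src = q.src ∧ r.tgt = q.tgt ∧ r.pathDist q = |r.pos - q.pos|) ∨
        (r.src = q.tgt ∧ r.tgt = q.src ∧ r.pathDist q = |r.pos - (1 - q.pos)|) := by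
      rw [pathDist_comm r q]
      rcases h' with ⟨h1, h2, h'⟩ | ⟨h1, h2, h'⟩
      · exact Or.inl ⟨h1.symm, h2.symm, by rw [h', abs_sub_comm]⟩
      · exact Or.inr ⟨h2.symm, h1.symm, by
          rw [h', show q.pos - (1 - r.pos) = r.pos - (1 - q.pos) by ring]⟩
    have h3 : q.pathDist p = q.off j + (G.dist (q.vert j) (p.vert i) : ℝ) + p.off i := by
      rw [pathDist_comm q p, h, SimpleGraph.dist_comm]; ring
    have := triangle_along_through h'' h3
    rw [pathDist_comm r p, pathDist_comm r q, pathDist_comm q p] at this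
    linarith
  · have t := pathDist_le_through p r i k
    have tri : ∀ a b c : V, (G.dist a c : ℝ) ≤ G.dist a b + G.dist b c := fun a b c => by
      exact_mod_cast hG.dist_triangle
    have o1 := q.off_nonneg j
    have o2 := q.off_nonneg j'
    have t1 := tri (p.vert i) (q.vert j) (r.vert k)
    by_cases hjj : j = j'
    · subst hjj
      linarith
    · have t2 := tri (q.vert j) (q.vert j') (r.vert k)
      have t3 := q.dist_vert_le j j' hjj
      linarith

noncomputable instance : PseudoMetricSpace (MetricGraphRep G hG) where
  dist := pathDist
  dist_self := pathDist_self
  dist_comm := pathDist_comm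
  dist_triangle := pathDist_triangle

end MetricGraphRep

/-- The metric graph of a connected graph, every edge being isometric to `[0, 1]`: representatives
at distance zero are identified. It is a metric space with the path distance. -/
abbrev MetricGraph {V : Type*} (G : SimpleGraph V) (hG : G.Connected) : Type _ :=
  SeparationQuotient (MetricGraphRep G hG)

/-! ### Hyperbolic spaces -/

/-- The Gromov product `(x|y)_o`. -/
noncomputable def gromovProduct {X : Type*} [MetricSpace X] (o x y : X) : ℝ :=
  (dist x o + dist y o - dist x y) / 2

/-- Gromov hyperbolicity, by the `δ`-inequality. -/
def IsGromovHyperbolic (X : Type*) [MetricSpace X] : Prop :=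
  ∃ δ : ℝ, 0 ≤ δ ∧ ∀ o x y z : X,
    min (gromovProduct o x z) (gromovProduct o z y) - δ ≤ gromovProduct o x y

/-- `X` has a pole: for some point `v` and some `M > 0`, every point of `X` is at distance less
than `M` from some geodesic ray emanating from `v`. -/
def HasPole (X : Type*) [MetricSpace X] : Prop :=
  ∃ v : X, ∃ M : ℝ, 0 < M ∧ ∀ x : X,
    ∃ γ : ℝ≥0 → X, Isometry γ ∧ γ 0 = v ∧ ∃ t : ℝ≥0, dist x (γ t) < M

/-- A metric space is uniformly perfect if for some `S > 1` and `ε₀ > 0`, every `x` and every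
`0 < ε ≤ ε₀` admit a point `y` with `ε / S < d(x, y) ≤ ε`. -/
def IsUniformlyPerfect (Y : Type*) [MetricSpace Y] : Prop :=
  ∃ S : ℝ, 1 < S ∧ ∃ ε₀ : ℝ, 0 < ε₀ ∧ ∀ x : Y, ∀ ε : ℝ, 0 < ε → ε ≤ ε₀ →
    ∃ y : Y, ε / S < dist x y ∧ dist x y ≤ ε

/-! ### The sequential boundary at infinity -/

/-- The sequence `x` converges to infinity: `(x_i|x_j)_o → ∞` as `i, j → ∞`. -/
def ConvergesToInfinity {X : Type*} [MetricSpace X] (x : ℕ → X) : Prop :=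
  ∀ o : X, Tendsto (fun ij : ℕ × ℕ => gromovProduct o (x ij.1) (x ij.2)) atTop atTop

theorem gromovProduct_comm {X : Type*} [MetricSpace X] (o x y : X) :
    gromovProduct o x y = gromovProduct o y x := by
  simp only [gromovProduct, dist_comm x y]; ring

/-- Equivalence of sequences converging to infinity: `(x_i|y_i)_o → ∞`. -/
def boundarySetoid {X : Type*} [MetricSpace X] (hX : IsGromovHyperbolic X) :
    Setoid {x : ℕ → X // ConvergesToInfinity x} where
  r x y := ∀ o : X, Tendsto (fun i => gromovProduct o (x.1 i) (y.1 i)) atTop atTop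
  iseqv :=
    { refl := fun x o => (x.2 o).comp (tendsto_atTop_diagonal (α := ℕ))
      symm := fun {x y} h o => by
        simpa only [gromovProduct_comm o (x.1 _) (y.1 _)] using h o
      trans := fun {x y z} h h' o => by
        obtain ⟨δ, -, hδ⟩ := hX
        refine tendsto_atTop_mono (fun i => hδ o (x.1 i) (z.1 i) (y.1 i)) ?_
        refine tendsto_atTop_add_const_right _ (-δ) ?_
        rw [tendsto_atTop]
        intro b
        filter_upwards [(tendsto_atTop.1 (h o)) b, (tendsto_atTop.1 (h' o)) b] with i h1 h2
        exact le_min h1 h2 }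

/-- The sequential boundary at infinity of a hyperbolic space. -/
def GromovBoundary (X : Type*) [MetricSpace X] (hX : IsGromovHyperbolic X) : Type _ :=
  Quotient (boundarySetoid hX)

/-- The Gromov product of two boundary points, `inf liminf_i (x_i|y_i)_o` over all sequences
representing them; it is infinite when the two points coincide. The Gromov products `(x_i|y_i)_o`
are nonnegative, so that taking values in `[0, ∞]` loses nothing. -/
noncomputable def boundaryProduct {X : Type*} [MetricSpace X] {hX : IsGromovHyperbolic X}
    (o : X) (ξ η : GromovBoundary X hX) : ℝ≥0∞ :=
  ⨅ (x : {x : ℕ → X // ConvergesToInfinity x}) (y : {x : ℕ → X // ConvergesToInfinity x})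
    (_ : Quotient.mk (boundarySetoid hX) x = ξ) (_ : Quotient.mk (boundarySetoid hX) y = η),
    liminf (fun i => ENNReal.ofReal (gromovProduct o (x.1 i) (y.1 i))) atTop

/-- `a ^ (-t)` for `a > 1` and `t ∈ [0, ∞]`, with `a ^ (-∞) = 0`. -/
noncomputable def expNeg (a : ℝ) (t : ℝ≥0∞) : ℝ :=
  if t = ∞ then 0 else a ^ (-t.toReal)

/-- The metric `d` on the boundary is visual: it is comparable with `a ^ (-(ξ|η)_o)` for some base
point `o` and some parameter `a > 1`. -/
def IsVisualMetric {X : Type*} [MetricSpace X] {hX : IsGromovHyperbolic X}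
    (d : MetricSpace (GromovBoundary X hX)) : Prop :=
  ∃ (o : X) (a c₁ c₂ : ℝ), 1 < a ∧ 0 < c₁ ∧ 0 < c₂ ∧ ∀ ξ η : GromovBoundary X hX,
    c₁ * expNeg a (boundaryProduct o ξ η) ≤ d.dist ξ η ∧
      d.dist ξ η ≤ c₂ * expNeg a (boundaryProduct o ξ η)

/-!
Seen from a vertex `p`, the vertices have directions, and `a ^ (-(y|x)_p)` measures the angle
between two of them; for `a > 1` close to one, chains turn it into an actual metric up to a factor
`2`. The same construction on the boundary gives visual metrics. As the Gromov product is the height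
at which two directions branch, a visual metric is uniformly perfect precisely when every boundary
point has others branching off at all heights, up to a bounded error.

Suppose that `|∂A| ≥ h |A|` for all finite `A`, and let `S` be a finite set of vertices. Consider
the set of vertices `y` whose direction at `p` has an angle greater than `θ` with all directions in
`S`. Stepping to a neighbour changes an angle by a factor exponentially close to one, unless `y`
lies near one of the geodesics from `p` to `S`, and there are few such `y`. So this set gains a
factor `1 + h` each time `θ` decreases by a term of a convergent geometric series, and it is
infinite before `θ` has dropped by a half: avoiding finitely many directions leaves infinitely many
vertices. König's lemma turns infinite sets of vertices into geodesic rays. Avoiding the direction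
of `o` at `x` yields a ray from `o` passing close to `x`, hence a pole. Avoiding the directions of
`o` and of a boundary point `ξ`, at a vertex on the way from `o` to `ξ`, yields a boundary point
that branches off from `ξ` there.

Conversely, if there is a pole, then every vertex `x` lies close to the way from `o` to some
boundary point, and if all boundary points branch at all heights, then `x` has any given number `m`
of descendants a bounded number `R` of steps further away from `o`. Moving every vertex `R` steps
back towards `o` is thus a map at bounded distance from the identity which sends at least `m`
vertices close to each vertex. For large `m`, this forces a neighbourhood of bounded radius of a
finite set `A` to have at least `2 |A|` elements, and in a graph of bounded degree this bounds
`|∂A| / |A|` from below.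
-/

/-! ### Gromov products -/

section GromovProduct

variable {X Y : Type*} [MetricSpace X] [MetricSpace Y]

theorem gromovProduct_self (o x : X) : gromovProduct o x x = dist x o := by
  rw [gromovProduct, dist_self]; ring

theorem gromovProduct_nonneg (o x y : X) : 0 ≤ gromovProduct o x y := by
  have := dist_triangle_right x y o
  rw [gromovProduct]; linarith

theorem gromovProduct_le_dist_left (o x y : X) : gromovProduct o x y ≤ dist x o := by
  have := dist_triangle_left y o x
  rw [gromovProduct]; linarith

theorem gromovProduct_le_dist_right (o x y : X) : gromovProduct o x y ≤ dist y o :=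
  gromovProduct_comm o x y ▸ gromovProduct_le_dist_left o y x

theorem gromovProduct_le_add_dist_right (o x y z : X) :
    gromovProduct o x y ≤ gromovProduct o x z + dist y z := by
  have h1 := dist_triangle y z o
  have h2 := dist_triangle x y z
  rw [gromovProduct, gromovProduct]; linarith

theorem gromovProduct_le_add_dist_left (o x y z : X) :
    gromovProduct o x y ≤ gromovProduct o z y + dist x z := by
  rw [gromovProduct_comm o x y, gromovProduct_comm o z y]
  exact gromovProduct_le_add_dist_right o y x z

theorem gromovProduct_le_add_dist_base (o o' x y : X) :
    gromovProduct o x y ≤ gromovProduct o' x y + dist o o' := by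
  have h1 := dist_triangle_right x o o'
  have h2 := dist_triangle_right y o o'
  rw [gromovProduct, gromovProduct]; linarith

theorem gromovProduct_add_gromovProduct (o p x : X) :
    gromovProduct o p x + gromovProduct p o x = dist o p := by
  rw [gromovProduct, gromovProduct, dist_comm p o, dist_comm x o, dist_comm x p]; ring

theorem dist_eq_sub_gromovProduct (o x y : X) :
    dist x y = dist o x + dist o y - 2 * gromovProduct o x y := by
  rw [gromovProduct, dist_comm o x, dist_comm o y]; ring

theorem gromovProduct_eq_dist_of_between {o w y : X} (h : dist o w + dist w y = dist o y) :
    gromovProduct o w y = dist o w := by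
  rw [gromovProduct, dist_comm w o, dist_comm y o]; linarith

theorem dist_le_gromovProduct_of_between {o w x y : X} (hx : dist o w + dist w x = dist o x)
    (hy : dist o w + dist w y = dist o y) : dist o w ≤ gromovProduct o x y := by
  have := dist_triangle_left x y w
  rw [gromovProduct, dist_comm x o, dist_comm y o]; linarith

theorem gromovProduct_map {f : X → Y} (hf : Isometry f) (o x y : X) :
    gromovProduct (f o) (f x) (f y) = gromovProduct o x y := by
  simp only [gromovProduct, hf.dist_eq]

end GromovProduct

/-! ### The `δ`-inequality -/

/-- The `δ`-inequality for Gromov products: hyperbolicity with a specified constant. -/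
def DeltaInequality (X : Type*) [MetricSpace X] (δ : ℝ) : Prop :=
  ∀ o x y z : X, min (gromovProduct o x z) (gromovProduct o z y) - δ ≤ gromovProduct o x y

theorem IsGromovHyperbolic.exists_deltaInequality {X : Type*} [MetricSpace X]
    (h : IsGromovHyperbolic X) : ∃ δ, DeltaInequality X δ :=
  h.imp fun _ hδ => hδ.2

namespace DeltaInequality

variable {X Y : Type*} [MetricSpace X] [MetricSpace Y] {δ s : ℝ}

theorem nonneg (hδ : DeltaInequality X δ) (o : X) : 0 ≤ δ := by
  have := hδ o o o o
  rw [min_self] at this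
  linarith

theorem of_isometry {f : X → Y} (hf : Isometry f) (hδ : DeltaInequality Y δ) :
    DeltaInequality X δ := fun o x y z => by
  simpa only [gromovProduct_map hf] using hδ (f o) (f x) (f y) (f z)

theorem sub_le_gromovProduct (hδ : DeltaInequality X δ) {o x y z : X}
    (hxz : s ≤ gromovProduct o x z) (hzy : s ≤ gromovProduct o z y) :
    s - δ ≤ gromovProduct o x y :=
  (sub_le_sub_right (le_min hxz hzy) _).trans (hδ o x y z)

theorem gromovProduct_le_add (hδ : DeltaInequality X δ) {o x y z : X}
    (hxy : gromovProduct o x y ≤ s) (hxz : s + δ < gromovProduct o x z) :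
    gromovProduct o z y ≤ s + δ := by
  by_contra! hzy
  have := (sub_lt_sub_right (lt_min hxz hzy) δ).trans_le (hδ o x y z)
  linarith

theorem sub_le_gromovProduct_of_between (hδ : DeltaInequality X δ) {p w x y : X}
    (hw : dist p w + dist w x = dist p x) (hpw : s ≤ dist p w) (hyx : s ≤ gromovProduct p y x) :
    s - δ ≤ gromovProduct p y w :=
  hδ.sub_le_gromovProduct hyx <| by
    rwa [gromovProduct_comm, gromovProduct_eq_dist_of_between hw]

theorem dist_le_of_between (hδ : DeltaInequality X δ) {p w x y : X}
    (hw : dist p w + dist w x = dist p x) (hpw : s ≤ dist p w) (hyx : s ≤ gromovProduct p y x) :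
    dist y w ≤ dist p y + dist p w - 2 * s + 2 * δ := by
  have := hδ.sub_le_gromovProduct_of_between hw hpw hyx
  have := dist_eq_sub_gromovProduct p y w
  linarith

end DeltaInequality

/-! ### Sequences converging to infinity -/

section ConvergesToInfinity

variable {X Y : Type*} [MetricSpace X] [MetricSpace Y]

theorem convergesToInfinity_of_tendsto {x : ℕ → X} (o : X)
    (h : Tendsto (fun ij : ℕ × ℕ => gromovProduct o (x ij.1) (x ij.2)) atTop atTop) :
    ConvergesToInfinity x := fun o' =>
  tendsto_atTop_mono (fun ij => sub_le_iff_le_add.2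
    (gromovProduct_le_add_dist_base o o' (x ij.1) (x ij.2)))
    (tendsto_atTop_add_const_right _ (-dist o o') h)

theorem ConvergesToInfinity.of_le {x : ℕ → X} {y : ℕ → Y} (hx : ConvergesToInfinity x) (o : X)
    (o' : Y) (C : ℝ)
    (h : ∀ i j, gromovProduct o (x i) (x j) ≤ gromovProduct o' (y i) (y j) + C) :
    ConvergesToInfinity y :=
  convergesToInfinity_of_tendsto o' <|
    tendsto_atTop_mono (fun ij => sub_le_iff_le_add.2 (h ij.1 ij.2))
      (tendsto_atTop_add_const_right _ (-C) (hx o))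

theorem ConvergesToInfinity.tendsto_dist {x : ℕ → X} (hx : ConvergesToInfinity x) (o : X) :
    Tendsto (fun i => dist o (x i)) atTop atTop := by
  have := (hx o).comp (tendsto_atTop_diagonal (α := ℕ))
  simpa only [Function.comp_def, gromovProduct_self, dist_comm _ o] using this

theorem isometry_of_dist_succ_le {f : ℕ → X} (hsucc : ∀ n, dist (f n) (f (n + 1)) ≤ 1)
    (hzero : ∀ n : ℕ, n ≤ dist (f 0) (f n)) : Isometry f := by
  have hle : ∀ m n, m ≤ n → dist (f m) (f n) ≤ n - m := fun m n hmn => by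
    simpa [Nat.cast_sub hmn] using
      dist_le_Ico_sum_of_dist_le (d := fun _ => (1 : ℝ)) hmn fun {k} _ _ => hsucc k
  have heq : ∀ m n, m ≤ n → dist (f m) (f n) = dist m n := fun m n hmn => by
    rw [Nat.dist_eq, abs_sub_comm, abs_of_nonneg (sub_nonneg.2 (by exact_mod_cast hmn))]
    have hm := hle 0 m m.zero_le
    have := dist_triangle (f 0) (f m) (f n)
    exact le_antisymm (hle m n hmn) (by push_cast at hm; linarith [hzero n])
  refine Isometry.of_dist_eq fun m n => ?_
  rcases le_total m n with hmn | hnm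
  · exact heq m n hmn
  · rw [dist_comm, heq n m hnm, dist_comm]

variable {f : ℕ → X}

theorem dist_ray_zero (hf : Isometry f) (n : ℕ) : dist (f 0) (f n) = n := by
  rw [hf.dist_eq, Nat.dist_eq]; simp

theorem dist_add_dist_ray (hf : Isometry f) {m n : ℕ} (hmn : m ≤ n) :
    dist (f 0) (f m) + dist (f m) (f n) = dist (f 0) (f n) := by
  have : (m : ℝ) ≤ n := by exact_mod_cast hmn
  rw [dist_ray_zero hf, dist_ray_zero hf, hf.dist_eq, Nat.dist_eq, abs_sub_comm,
    abs_of_nonneg (sub_nonneg.2 this)]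
  ring

theorem gromovProduct_ray (hf : Isometry f) (m n : ℕ) :
    gromovProduct (f 0) (f m) (f n) = min m n := by
  wlog hmn : m ≤ n generalizing m n
  · rw [gromovProduct_comm, this n m (le_of_not_ge hmn), min_comm]
  rw [gromovProduct_eq_dist_of_between (dist_add_dist_ray hf hmn), dist_ray_zero hf,
    min_eq_left (by exact_mod_cast hmn)]

theorem convergesToInfinity_ray (hf : Isometry f) : ConvergesToInfinity f := by
  refine convergesToInfinity_of_tendsto (f 0) (tendsto_atTop.2 fun b => ?_)
  obtain ⟨N, hN⟩ := exists_nat_ge b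
  refine eventually_atTop_prod_self'.2 ⟨N, fun m hm n hn => ?_⟩
  rw [gromovProduct_ray hf, Nat.cast_min]
  exact le_min (hN.trans (Nat.cast_le.2 hm)) (hN.trans (Nat.cast_le.2 hn))

end ConvergesToInfinity

/-! ### Quasi-ultrametrics are comparable with metrics -/

theorem expNeg_top (a : ℝ) : expNeg a ∞ = 0 := if_pos rfl

theorem expNeg_ofReal (a : ℝ) {t : ℝ} (ht : 0 ≤ t) :
    expNeg a (ENNReal.ofReal t) = a ^ (-t) := by
  rw [expNeg, if_neg ENNReal.ofReal_ne_top, ENNReal.toReal_ofReal ht]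

section ExpNeg

variable {a : ℝ}

theorem expNeg_nonneg (ha : 0 ≤ a) (t : ℝ≥0∞) : 0 ≤ expNeg a t := by
  rw [expNeg]
  split_ifs <;> positivity

theorem expNeg_pos (ha : 0 < a) {t : ℝ≥0∞} (ht : t ≠ ∞) : 0 < expNeg a t := by
  rw [expNeg, if_neg ht]
  positivity

theorem expNeg_le_rpow_neg_iff (ha : 1 < a) {s : ℝ} {t : ℝ≥0∞} :
    expNeg a t ≤ a ^ (-s) ↔ ENNReal.ofReal s ≤ t := by
  induction t using ENNReal.recTopCoe with
  | top => simp only [expNeg_top, le_top, iff_true]; positivity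
  | coe r =>
    rw [← ENNReal.ofReal_coe_nnreal, expNeg_ofReal a r.coe_nonneg, Real.rpow_le_rpow_left_iff ha,
      neg_le_neg_iff, ENNReal.ofReal_le_ofReal_iff r.coe_nonneg]

theorem expNeg_antitone (ha : 1 < a) : Antitone (expNeg a) := fun s t hst => by
  induction s using ENNReal.recTopCoe with
  | top => rw [top_le_iff.1 hst]
  | coe r =>
    rw [← ENNReal.ofReal_coe_nnreal] at hst ⊢
    rw [expNeg_ofReal a r.coe_nonneg]
    exact (expNeg_le_rpow_neg_iff ha).2 hst

theorem expNeg_add_ofReal (ha : 0 < a) (t : ℝ≥0∞) {c : ℝ} (hc : 0 ≤ c) :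
    expNeg a (t + ENNReal.ofReal c) = a ^ (-c) * expNeg a t := by
  induction t using ENNReal.recTopCoe with
  | top => rw [top_add, expNeg_top, mul_zero]
  | coe r =>
    rw [← ENNReal.ofReal_coe_nnreal, ← ENNReal.ofReal_add r.coe_nonneg hc,
      expNeg_ofReal a (by positivity), expNeg_ofReal a r.coe_nonneg,
      ← Real.rpow_add (by positivity), neg_add_rev]

end ExpNeg

theorem exists_pseudoMetricSpace_comparable_expNeg {Y : Type*} (q : Y → Y → ℝ≥0∞) {δ a : ℝ}
    (hδ : 0 ≤ δ) (ha : 1 < a) (haδ : a ^ (2 * δ) ≤ 2) (hself : ∀ x, q x x = ∞)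
    (hcomm : ∀ x y, q x y = q y x)
    (hq : ∀ x y z, min (q x y) (q y z) ≤ q x z + ENNReal.ofReal δ) :
    ∃ d : PseudoMetricSpace Y, ∀ x y, d.dist x y ≤ expNeg a (q x y) ∧
      expNeg a (q x y) ≤ 2 * d.dist x y := by
  have ha₀ : 0 < a := zero_lt_one.trans ha
  let e : Y → Y → ℝ≥0 := fun x y => ⟨expNeg a (q x y), expNeg_nonneg ha₀.le _⟩
  have e_self : ∀ x, e x x = 0 := fun x => NNReal.eq (by
    change expNeg a (q x x) = 0; rw [hself, expNeg_top])
  have e_comm : ∀ x y, e x y = e y x := fun x y => NNReal.eq (by simp only [e, hcomm x y])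
  refine ⟨PseudoMetricSpace.ofPreNNDist e e_self e_comm, fun x y =>
    ⟨PseudoMetricSpace.dist_ofPreNNDist_le e e_self e_comm x y,
      PseudoMetricSpace.le_two_mul_dist_ofPreNNDist e e_self e_comm (fun x₁ x₂ x₃ x₄ => ?_) x y⟩⟩
  have hmin : min (q x₁ x₂) (min (q x₂ x₃) (q x₃ x₄)) ≤ q x₁ x₄ + ENNReal.ofReal (2 * δ) :=
    calc min (q x₁ x₂) (min (q x₂ x₃) (q x₃ x₄))
      _ ≤ min (q x₁ x₂ + ENNReal.ofReal δ) (q x₂ x₄ + ENNReal.ofReal δ) :=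
          min_le_min le_self_add (hq x₂ x₃ x₄)
      _ = min (q x₁ x₂) (q x₂ x₄) + ENNReal.ofReal δ := min_add_add_right _ _ _
      _ ≤ q x₁ x₄ + ENNReal.ofReal δ + ENNReal.ofReal δ := by gcongr; exact hq x₁ x₂ x₄
      _ = q x₁ x₄ + ENNReal.ofReal (2 * δ) := by rw [two_mul, ENNReal.ofReal_add hδ hδ, add_assoc]
  change expNeg a (q x₁ x₄) ≤ 2 * max (expNeg a (q x₁ x₂))
    (max (expNeg a (q x₂ x₃)) (expNeg a (q x₃ x₄)))
  rw [← (expNeg_antitone ha).map_min, ← (expNeg_antitone ha).map_min]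
  calc expNeg a (q x₁ x₄) = a ^ (2 * δ) * expNeg a (q x₁ x₄ + ENNReal.ofReal (2 * δ)) := by
        rw [expNeg_add_ofReal ha₀ _ (by positivity), ← mul_assoc, ← Real.rpow_add (by positivity),
          add_neg_cancel, Real.rpow_zero, one_mul]
    _ ≤ _ := mul_le_mul haδ (expNeg_antitone ha hmin) (expNeg_nonneg ha₀.le _) zero_le_two

theorem exists_one_lt_rpow_two_mul_le_two {δ : ℝ} (hδ : 0 ≤ δ) :
    ∃ a : ℝ, 1 < a ∧ a ^ (2 * δ) ≤ 2 := by
  refine ⟨2 ^ (1 / (2 * δ + 1)), Real.one_lt_rpow one_lt_two (by positivity), ?_⟩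
  rw [← Real.rpow_mul zero_le_two]
  calc (2 : ℝ) ^ (1 / (2 * δ + 1) * (2 * δ)) ≤ 2 ^ (1 : ℝ) := by
        refine Real.rpow_le_rpow_of_exponent_le one_le_two ?_
        rw [one_div_mul_eq_div, div_le_one (by positivity)]
        linarith
    _ = 2 := Real.rpow_one 2

/-- `F` plays the role of the distance to `x` for a visual metric with parameter `a` and base point
`p`, extended to the points of the space itself: it is comparable with `a ^ (-(y|x)_p)` and varies
by at most `a ^ (-(y|z)_p)` between `y` and `z`. -/
structure IsVisualDistance {X : Type*} [MetricSpace X] (a : ℝ) (p x : X) (F : X → ℝ) : Prop where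
  le_rpow : ∀ y, F y ≤ a ^ (-gromovProduct p y x)
  rpow_le : ∀ y, a ^ (-gromovProduct p y x) ≤ 2 * F y
  le_add : ∀ y z, F y ≤ F z + a ^ (-gromovProduct p y z)

namespace DeltaInequality

variable {X : Type*} [MetricSpace X] {δ a : ℝ}

theorem exists_pseudoMetricSpace (hδ : DeltaInequality X δ) (ha : 1 < a) (haδ : a ^ (2 * δ) ≤ 2)
    (p : X) :
    ∃ d : PseudoMetricSpace X, (∀ y z, d.dist y z ≤ a ^ (-gromovProduct p y z)) ∧
      ∀ y z, y ≠ z → a ^ (-gromovProduct p y z) ≤ 2 * d.dist y z := by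
  classical
  let q : X → X → ℝ≥0∞ := fun y z => if y = z then ∞ else ENNReal.ofReal (gromovProduct p y z)
  have hq : ∀ y z, y ≠ z → q y z = ENNReal.ofReal (gromovProduct p y z) := fun y z hyz =>
    if_neg hyz
  have hle : ∀ y z, ENNReal.ofReal (gromovProduct p y z) ≤ q y z := fun y z => by
    simp only [q]; split_ifs <;> simp
  have hcomm : ∀ y z, q y z = q z y := fun y z => by
    simp only [q, eq_comm, gromovProduct_comm p y]
  have hmin : ∀ u v w, min (q u v) (q v w) ≤ q u w + ENNReal.ofReal δ := fun u v w => by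
    by_cases huw : u = w
    · simp [q, huw]
    by_cases huv : u = v
    · exact (min_le_right _ _).trans (huv ▸ le_self_add)
    by_cases hvw : v = w
    · exact (min_le_left _ _).trans (hvw ▸ le_self_add)
    rw [hq u v huv, hq v w hvw, hq u w huw, ← ENNReal.ofReal_min,
      ← ENNReal.ofReal_add (gromovProduct_nonneg _ _ _) (hδ.nonneg p)]
    exact ENNReal.ofReal_le_ofReal (sub_le_iff_le_add.1 (hδ p u w v))
  obtain ⟨d, hd⟩ := exists_pseudoMetricSpace_comparable_expNeg q (hδ.nonneg p) ha haδ
    (fun y => if_pos rfl) hcomm hmin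
  refine ⟨d, fun y z => (hd y z).1.trans ((expNeg_le_rpow_neg_iff ha).2 (hle y z)),
    fun y z hyz => ?_⟩
  rw [← expNeg_ofReal a (gromovProduct_nonneg p y z), ← hq y z hyz]
  exact (hd y z).2

theorem exists_isVisualDistance (hδ : DeltaInequality X δ) (ha : 1 < a) (haδ : a ^ (2 * δ) ≤ 2)
    (p x : X) : ∃ F : X → ℝ, IsVisualDistance a p x F := by
  obtain ⟨d, hle, hge⟩ := hδ.exists_pseudoMetricSpace ha haδ p
  refine ⟨fun y => max (d.dist y x) (a ^ (-gromovProduct p x x) / 2), fun y => ?_, fun y => ?_,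
    fun y z => ?_⟩
  · refine max_le (hle y x) ((half_le_self (by positivity)).trans ?_)
    rw [Real.rpow_le_rpow_left_iff ha, neg_le_neg_iff, gromovProduct_self]
    exact gromovProduct_le_dist_right p y x
  · rcases eq_or_ne y x with rfl | hyx
    · linarith [le_max_right (d.dist y y) (a ^ (-gromovProduct p y y) / 2)]
    · linarith [hge y x hyx, le_max_left (d.dist y x) (a ^ (-gromovProduct p x x) / 2)]
  · refine max_le ?_ ((le_max_right _ _).trans (le_add_of_nonneg_right (by positivity)))
    linarith [d.dist_triangle y z x, hle y z,
      le_max_left (d.dist z x) (a ^ (-gromovProduct p x x) / 2)]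

end DeltaInequality

/-! ### The Gromov product on the boundary -/

section Boundary

variable {X : Type*} [MetricSpace X] {hX : IsGromovHyperbolic X} {o : X} {ξ η : GromovBoundary X hX}
  {x y : ℕ → X} {hx : ConvergesToInfinity x} {hy : ConvergesToInfinity y} {δ t : ℝ}

/-- The point of the boundary represented by a sequence converging to infinity. -/
def ConvergesToInfinity.limit (hx : ConvergesToInfinity x) (hX : IsGromovHyperbolic X) :
    GromovBoundary X hX :=
  Quotient.mk (boundarySetoid hX) ⟨x, hx⟩

theorem exists_limit_eq (ξ : GromovBoundary X hX) :
    ∃ (x : ℕ → X) (hx : ConvergesToInfinity x), hx.limit hX = ξ := by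
  obtain ⟨⟨x, hx⟩, h⟩ := Quotient.exists_rep ξ
  exact ⟨x, hx, h⟩

theorem limit_eq_limit_iff :
    hx.limit hX = hy.limit hX ↔ ∀ o, Tendsto (fun i => gromovProduct o (x i) (y i)) atTop atTop :=
  Quotient.eq

theorem le_boundaryProduct
    (h : ∀ (x y : ℕ → X) (hx : ConvergesToInfinity x) (hy : ConvergesToInfinity y),
      hx.limit hX = ξ → hy.limit hX = η → ∀ᶠ i in atTop, t ≤ gromovProduct o (x i) (y i)) :
    ENNReal.ofReal t ≤ boundaryProduct o ξ η :=
  le_iInf fun x => le_iInf fun y => le_iInf fun hx => le_iInf fun hy =>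
    le_liminf_of_le (by isBoundedDefault) <|
      (h x.1 y.1 x.2 y.2 hx hy).mono fun _ => ENNReal.ofReal_le_ofReal

theorem boundaryProduct_limit_le_liminf (o : X) (hx : ConvergesToInfinity x)
    (hy : ConvergesToInfinity y) :
    boundaryProduct o (hx.limit hX) (hy.limit hX) ≤
      liminf (fun i => ENNReal.ofReal (gromovProduct o (x i) (y i))) atTop :=
  iInf_le_of_le ⟨x, hx⟩ <| iInf_le_of_le ⟨y, hy⟩ <| iInf_le_of_le rfl <| iInf_le _ rfl

theorem boundaryProduct_limit_le_of_frequently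
    (h : ∃ᶠ i in atTop, gromovProduct o (x i) (y i) ≤ t) :
    boundaryProduct o (hx.limit hX) (hy.limit hX) ≤ ENNReal.ofReal t :=
  (boundaryProduct_limit_le_liminf o hx hy).trans <|
    liminf_le_of_frequently_le' (h.mono fun _ => ENNReal.ofReal_le_ofReal)

theorem eventually_lt_of_lt_boundaryProduct
    (h : ENNReal.ofReal t < boundaryProduct o (hx.limit hX) (hy.limit hX)) :
    ∀ᶠ i in atTop, t < gromovProduct o (x i) (y i) :=
  (eventually_lt_of_lt_liminf (h.trans_le (boundaryProduct_limit_le_liminf o hx hy))).mono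
    fun _ hi => (ENNReal.ofReal_lt_ofReal_iff'.1 hi).1

theorem exists_frequently_of_boundaryProduct_lt
    (h : boundaryProduct o ξ η < ENNReal.ofReal t) :
    ∃ (x y : ℕ → X) (hx : ConvergesToInfinity x) (hy : ConvergesToInfinity y),
      hx.limit hX = ξ ∧ hy.limit hX = η ∧ ∃ᶠ i in atTop, gromovProduct o (x i) (y i) ≤ t := by
  simp only [boundaryProduct, iInf_lt_iff] at h
  obtain ⟨x, y, hx, hy, h⟩ := h
  exact ⟨x.1, y.1, x.2, y.2, hx, hy, (frequently_lt_of_liminf_lt (by isBoundedDefault) h).mono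
    fun i hi => (ENNReal.ofReal_lt_ofReal_iff'.1 hi).1.le⟩

theorem boundaryProduct_comm (o : X) (ξ η : GromovBoundary X hX) :
    boundaryProduct o ξ η = boundaryProduct o η ξ := by
  rw [boundaryProduct, boundaryProduct, iInf_comm]
  refine iInf_congr fun y => iInf_congr fun x => ?_
  rw [iInf_comm]
  simp only [gromovProduct_comm o]

theorem boundaryProduct_self (o : X) (ξ : GromovBoundary X hX) : boundaryProduct o ξ ξ = ∞ := by
  refine ENNReal.eq_top_of_forall_nnreal_le fun r => ?_
  rw [← ENNReal.ofReal_coe_nnreal]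
  exact le_boundaryProduct fun x y hx hy hxξ hyξ =>
    (limit_eq_limit_iff.1 (hxξ.trans hyξ.symm) o).eventually_ge_atTop r

theorem eq_of_boundaryProduct_eq_top (h : boundaryProduct o ξ η = ∞) : ξ = η := by
  obtain ⟨x, hx, rfl⟩ := exists_limit_eq ξ
  obtain ⟨y, hy, rfl⟩ := exists_limit_eq η
  refine limit_eq_limit_iff.2 fun o' => tendsto_atTop.2 fun b => ?_
  filter_upwards [eventually_lt_of_lt_boundaryProduct (t := b + dist o o')
    (h ▸ ENNReal.ofReal_lt_top)] with i hi
  linarith [gromovProduct_le_add_dist_base o o' (x i) (y i)]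

theorem min_boundaryProduct_le (hδ : DeltaInequality X δ) (o : X) (ξ η ζ : GromovBoundary X hX) :
    min (boundaryProduct o ξ η) (boundaryProduct o η ζ) ≤
      boundaryProduct o ξ ζ + ENNReal.ofReal δ := by
  refine ENNReal.le_of_forall_nnreal_lt fun s hs => ?_
  rw [← ENNReal.ofReal_coe_nnreal] at hs ⊢
  rw [lt_min_iff] at hs
  obtain ⟨y, hy, rfl⟩ := exists_limit_eq η
  have hle : ENNReal.ofReal (s - δ) ≤ boundaryProduct o ξ ζ := by
    refine le_boundaryProduct fun x z hx hz hxξ hzζ => ?_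
    rw [← hxξ, ← hzζ] at hs
    filter_upwards [eventually_lt_of_lt_boundaryProduct hs.1,
      eventually_lt_of_lt_boundaryProduct hs.2] with i hxy hyz
    exact hδ.sub_le_gromovProduct hxy.le hyz.le
  calc ENNReal.ofReal s = ENNReal.ofReal (s - δ + δ) := by rw [sub_add_cancel]
    _ ≤ ENNReal.ofReal (s - δ) + ENNReal.ofReal δ := ENNReal.ofReal_add_le
    _ ≤ boundaryProduct o ξ ζ + ENNReal.ofReal δ := by gcongr

theorem tendsto_gromovProduct_of_limit_eq (h : hx.limit hX = hy.limit hX) (o : X) :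
    Tendsto (fun ij : ℕ × ℕ => gromovProduct o (x ij.1) (y ij.2)) atTop atTop := by
  obtain ⟨δ, hδ⟩ := hX.exists_deltaInequality
  refine tendsto_atTop.2 fun b => ?_
  have hxy := (limit_eq_limit_iff.1 h o).comp (tendsto_snd (f := (atTop : Filter ℕ)))
  rw [prod_atTop_atTop_eq] at hxy
  filter_upwards [(hx o).eventually_ge_atTop (b + δ), hxy.eventually_ge_atTop (b + δ)]
    with ij hxi hyi
  linarith [hδ.sub_le_gromovProduct hxi hyi]

theorem le_boundaryProduct_limit (hδ : DeltaInequality X δ)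
    (h : ∀ᶠ i in atTop, t ≤ gromovProduct o (x i) (y i)) :
    ENNReal.ofReal (t - 2 * δ) ≤ boundaryProduct o (hx.limit hX) (hy.limit hX) := by
  refine le_boundaryProduct fun x' y' hx' hy' hxx hyy => ?_
  filter_upwards [h, (limit_eq_limit_iff.1 hxx o).eventually_ge_atTop t,
    (limit_eq_limit_iff.1 hyy.symm o).eventually_ge_atTop (t - δ)] with i hi hxi hyi
  linarith [hδ.sub_le_gromovProduct (hδ.sub_le_gromovProduct hxi hi) hyi]

theorem eventually_le_of_boundaryProduct_lt (hδ : DeltaInequality X δ)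
    (h : boundaryProduct o (hx.limit hX) (hy.limit hX) < ENNReal.ofReal t) :
    ∀ᶠ i in atTop, gromovProduct o (x i) (y i) ≤ t + 2 * δ := by
  obtain ⟨x', y', hx', hy', hxx, hyy, hfreq⟩ := exists_frequently_of_boundaryProduct_lt h
  have hxk := eventually_atTop_curry
    ((tendsto_gromovProduct_of_limit_eq hxx o).eventually_gt_atTop (t + δ))
  have hyk := eventually_atTop_curry
    ((tendsto_gromovProduct_of_limit_eq hyy o).eventually_gt_atTop (t + δ + δ))
  obtain ⟨k, hk, hxk, hyk⟩ := (hfreq.and_eventually (hxk.and hyk)).exists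
  filter_upwards [hxk, hyk] with i hxi hyi
  have hxy' := hδ.gromovProduct_le_add hk hxi
  rw [gromovProduct_comm] at hxy' ⊢
  linarith [hδ.gromovProduct_le_add hxy' hyi]

theorem exists_isVisualMetric [Nonempty X] (hX : IsGromovHyperbolic X) :
    ∃ d : MetricSpace (GromovBoundary X hX), IsVisualMetric d := by
  obtain ⟨δ, hδ⟩ := hX.exists_deltaInequality
  obtain ⟨o⟩ := ‹Nonempty X›
  obtain ⟨a, ha, haδ⟩ := exists_one_lt_rpow_two_mul_le_two (hδ.nonneg o)
  obtain ⟨d, hd⟩ := exists_pseudoMetricSpace_comparable_expNeg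
    (fun ξ η : GromovBoundary X hX => boundaryProduct o ξ η) (hδ.nonneg o) ha haδ
    (boundaryProduct_self o) (boundaryProduct_comm o) (min_boundaryProduct_le hδ o)
  refine ⟨{ d with eq_of_dist_eq_zero := fun {ξ η} h => ?_ }, o, a, 1 / 2, 1, ha, by norm_num,
    one_pos, fun ξ η => ⟨?_, ?_⟩⟩
  · by_contra hne
    have hpos := expNeg_pos (zero_lt_one.trans ha) (mt (eq_of_boundaryProduct_eq_top (o := o)) hne)
    have hzero : d.dist ξ η = 0 := h
    linarith [(hd ξ η).2, hzero]
  · linarith [(hd ξ η).2]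
  · exact (hd ξ η).1.trans_eq (one_mul _).symm

end Boundary

/-! ### Uniform perfectness in terms of sequences -/

/-- Every sequence converging to infinity has, at every depth `τ ≥ τ₀`, another one branching off
between depth `τ` and depth `τ + σ`. This is uniform perfectness of the boundary, expressed without
a visual metric. -/
def IsUniformlyBranching (X : Type*) [MetricSpace X] (o : X) : Prop :=
  ∃ τ₀ σ : ℝ, ∀ x : ℕ → X, ConvergesToInfinity x → ∀ τ ≥ τ₀, ∃ y : ℕ → X, ConvergesToInfinity y ∧
    ∀ᶠ i in atTop, gromovProduct o (x i) (y i) ∈ Icc τ (τ + σ)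

section Branching

variable {X Y : Type*} [MetricSpace X] [MetricSpace Y]

theorem IsUniformlyBranching.transfer {f : X → Y} {g : Y → X} {o : X} {o' : Y} {r : ℝ}
    (h : IsUniformlyBranching Y o') (hf : ∀ x, ConvergesToInfinity x → ConvergesToInfinity (f ∘ x))
    (hg : ∀ y, ConvergesToInfinity y → ConvergesToInfinity (g ∘ y))
    (hfg : ∀ x y, |gromovProduct o' (f x) y - gromovProduct o x (g y)| ≤ r) :
    IsUniformlyBranching X o := by
  obtain ⟨τ₀, σ, h⟩ := h
  refine ⟨τ₀ - r, σ + 2 * r, fun x hx τ hτ => ?_⟩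
  obtain ⟨y, hy, hxy⟩ := h (f ∘ x) (hf x hx) (τ + r) (sub_le_iff_le_add.1 hτ)
  refine ⟨g ∘ y, hg y hy, hxy.mono fun i ⟨hlo, hhi⟩ => ?_⟩
  have := abs_le.1 (hfg (x i) (y i))
  simp only [Function.comp_apply] at *
  constructor <;> linarith

theorem IsUniformlyBranching.change_base {o : X} (h : IsUniformlyBranching X o) (o' : X) :
    IsUniformlyBranching X o' :=
  h.transfer (f := id) (g := id) (r := dist o o') (fun _ => id) (fun _ => id) fun x y => by
    rw [abs_le, id, id]
    have := gromovProduct_le_add_dist_base o o' x y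
    have := gromovProduct_le_add_dist_base o' o x y
    rw [dist_comm o' o] at this
    constructor <;> linarith

theorem ConvergesToInfinity.of_dist_isometry_le {f : X → Y} (hf : Isometry f) (o : X) {c : ℝ}
    {x : ℕ → X} {y : ℕ → Y} (hy : ConvergesToInfinity y) (hxy : ∀ i, dist (y i) (f (x i)) ≤ c) :
    ConvergesToInfinity x :=
  hy.of_le (f o) o (2 * c) fun i j => by
    rw [← gromovProduct_map hf]
    linarith [gromovProduct_le_add_dist_left (f o) (y i) (y j) (f (x i)), hxy i, hxy j,
      gromovProduct_le_add_dist_right (f o) (f (x i)) (y j) (f (x j))]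

theorem isUniformlyBranching_iff_of_isometry {f : X → Y} (hf : Isometry f) {c : ℝ}
    (hc : ∀ y, ∃ x, dist y (f x) ≤ c) (o : X) :
    IsUniformlyBranching X o ↔ IsUniformlyBranching Y (f o) := by
  choose g hg using hc
  have hfg : ∀ x y, |gromovProduct (f o) (f x) y - gromovProduct o x (g y)| ≤ c := fun x y => by
    rw [← gromovProduct_map hf, abs_le]
    have := gromovProduct_le_add_dist_right (f o) (f x) y (f (g y))
    have := gromovProduct_le_add_dist_right (f o) (f x) (f (g y)) y
    rw [dist_comm (f (g y))] at this
    constructor <;> linarith [hg y]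
  have hf_conv : ∀ x, ConvergesToInfinity x → ConvergesToInfinity (f ∘ x) := fun x hx =>
    hx.of_le o (f o) 0 fun i j => by
      rw [Function.comp_apply, Function.comp_apply, gromovProduct_map hf, add_zero]
  have hg_conv : ∀ y, ConvergesToInfinity y → ConvergesToInfinity (g ∘ y) := fun y hy =>
    hy.of_dist_isometry_le hf o fun i => hg (y i)
  refine ⟨fun h => h.transfer (r := c) hg_conv hf_conv fun y x => ?_,
    fun h => h.transfer hf_conv hg_conv hfg⟩
  rw [gromovProduct_comm o, gromovProduct_comm (f o), abs_sub_comm]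
  exact hfg x y

variable {hX : IsGromovHyperbolic X} {d : MetricSpace (GromovBoundary X hX)}

theorem IsVisualMetric.isUniformlyBranching (hd : IsVisualMetric d)
    (h : IsUniformlyPerfect (GromovBoundary X hX)) (o : X) : IsUniformlyBranching X o := by
  obtain ⟨p, a, c₁, c₂, ha, hc₁, hc₂, hd⟩ := hd
  obtain ⟨S, hS, ε₀, hε₀, h⟩ := h
  obtain ⟨δ, hδ⟩ := hX.exists_deltaInequality
  obtain ⟨v, hv⟩ := pow_unbounded_of_one_lt (S * c₂ / c₁) ha
  obtain ⟨n, hn⟩ := pow_unbounded_of_one_lt (c₁ / ε₀) ha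
  refine IsUniformlyBranching.change_base (o := p) ⟨n, v + 1 + 2 * δ, fun x hx τ hτ => ?_⟩ o
  have hε : c₁ * a ^ (-(τ + 1)) ≤ ε₀ := by
    have : a ^ (-(τ + 1)) ≤ (a ^ n)⁻¹ := by
      rw [← Real.rpow_natCast, ← Real.rpow_neg (by positivity), Real.rpow_le_rpow_left_iff ha]
      linarith
    calc c₁ * a ^ (-(τ + 1)) ≤ c₁ * (a ^ n)⁻¹ := by gcongr
      _ ≤ ε₀ := by rw [← div_eq_mul_inv, div_le_comm₀ (by positivity) hε₀]; exact hn.le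
  obtain ⟨η, hlt, hle⟩ := h (hx.limit hX) _ (by positivity) hε
  obtain ⟨y, hy, rfl⟩ := exists_limit_eq η
  have hlower : ENNReal.ofReal (τ + 1) ≤ boundaryProduct p (hx.limit hX) (hy.limit hX) :=
    (expNeg_le_rpow_neg_iff ha).1 (le_of_mul_le_mul_left ((hd _ _).1.trans hle) hc₁)
  have hupper : boundaryProduct p (hx.limit hX) (hy.limit hX) < ENNReal.ofReal (τ + 1 + v) := by
    rw [← not_le, ← expNeg_le_rpow_neg_iff ha, not_le]
    refine lt_of_mul_lt_mul_left (lt_of_le_of_lt ?_ (hlt.trans_le (hd _ _).2)) hc₂.le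
    rw [neg_add', Real.rpow_sub (by positivity), Real.rpow_natCast]
    have := (div_lt_iff₀ hc₁).1 hv
    rw [mul_div_assoc', div_le_div_iff₀ (by positivity) (by positivity)]
    nlinarith [Real.rpow_pos_of_pos (zero_lt_one.trans ha) (-(τ + 1))]
  refine ⟨y, hy, ?_⟩
  have hlt : ENNReal.ofReal τ < ENNReal.ofReal (τ + 1) := by
    rw [ENNReal.ofReal_lt_ofReal_iff']
    exact ⟨by linarith, by linarith [n.cast_nonneg (α := ℝ)]⟩
  filter_upwards [eventually_lt_of_lt_boundaryProduct (hlt.trans_le hlower),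
    eventually_le_of_boundaryProduct_lt hδ hupper] with i hi₁ hi₂
  constructor <;> linarith

theorem IsVisualMetric.isUniformlyPerfect (hd : IsVisualMetric d) {o : X}
    (h : IsUniformlyBranching X o) : IsUniformlyPerfect (GromovBoundary X hX) := by
  obtain ⟨p, a, c₁, c₂, ha, hc₁, hc₂, hd⟩ := hd
  obtain ⟨τ₀, σ, h⟩ := h.change_base p
  obtain ⟨δ, hδ⟩ := hX.exists_deltaInequality
  refine ⟨1 + c₂ / c₁ * a ^ (2 * δ + σ), lt_add_of_pos_right _ (by positivity), c₂ * a ^ (-τ₀),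
    by positivity, fun ξ ε hε hε₀ => ?_⟩
  obtain ⟨x, hx, rfl⟩ := exists_limit_eq ξ
  obtain ⟨u, rfl⟩ : ∃ u : ℝ, c₂ * a ^ (-u) = ε := by
    refine ⟨-Real.logb a (ε / c₂), ?_⟩
    rw [neg_neg, Real.rpow_logb (by positivity) ha.ne' (by positivity), mul_div_cancel₀ _ hc₂.ne']
  have hu : τ₀ ≤ u := by
    rwa [mul_le_mul_iff_right₀ hc₂, Real.rpow_le_rpow_left_iff ha, neg_le_neg_iff] at hε₀
  obtain ⟨y, hy, hxy⟩ := h x hx (u + 2 * δ) (by linarith [hδ.nonneg p])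
  have hlower := le_boundaryProduct_limit (hX := hX) (hx := hx) (hy := hy) hδ
    (hxy.mono fun i hi => hi.1)
  have hupper := boundaryProduct_limit_le_of_frequently (hX := hX) (hx := hx) (hy := hy)
    (hxy.mono fun i hi => hi.2).frequently
  have hτσ : 0 ≤ u + 2 * δ + σ := by
    obtain ⟨i, hi⟩ := hxy.exists
    exact (gromovProduct_nonneg _ _ _).trans hi.2
  rw [add_sub_cancel_right] at hlower
  refine ⟨hy.limit hX, lt_of_lt_of_le ?_ (hd _ _).1,
    (hd _ _).2.trans (mul_le_mul_of_nonneg_left ((expNeg_le_rpow_neg_iff ha).2 hlower) hc₂.le)⟩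
  calc c₂ * a ^ (-u) / (1 + c₂ / c₁ * a ^ (2 * δ + σ))
    _ < c₂ * a ^ (-u) / (c₂ / c₁ * a ^ (2 * δ + σ)) := by gcongr; exact lt_one_add _
    _ = c₁ * a ^ (-(u + 2 * δ + σ)) := by
        rw [add_assoc, neg_add', Real.rpow_sub (by positivity)]
        field_simp
    _ ≤ c₁ * expNeg a (boundaryProduct p (hx.limit hX) (hy.limit hX)) := by
        rw [← expNeg_ofReal a hτσ]
        gcongr
        exact expNeg_antitone ha hupper

end Branching

/-! ### Graph metrics -/

/-- The metric on the vertices is the combinatorial distance of `G`. This is a class, so that the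
metric notions of the library apply to the vertices of a graph. -/
class IsGraphMetric {V : Type*} [MetricSpace V] (G : SimpleGraph V) : Prop where
  dist_eq (u v : V) : dist u v = G.dist u v

/-- The metric space of the vertices of a connected graph. -/
noncomputable abbrev graphMetricSpace {V : Type*} {G : SimpleGraph V} (hG : G.Connected) :
    MetricSpace V where
  dist u v := G.dist u v
  dist_self u := by simp
  dist_comm u v := by rw [SimpleGraph.dist_comm]
  dist_triangle u v w := by exact_mod_cast hG.dist_triangle
  eq_of_dist_eq_zero h := hG.dist_eq_zero_iff.1 (by exact_mod_cast h)

theorem isGraphMetric_graphMetricSpace {V : Type*} {G : SimpleGraph V} (hG : G.Connected) :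
    @IsGraphMetric V (graphMetricSpace hG) G :=
  @IsGraphMetric.mk V (graphMetricSpace hG) G fun _ _ => rfl

/-- Every vertex has less than `D` neighbours, that is, balls of radius one have at most `D`
elements. -/
def DegreeLT {V : Type*} (G : SimpleGraph V) (D : ℕ) : Prop :=
  ∀ v, (G.neighborSet v).encard < D

theorem IsUniformGraph.exists_degreeLT {V : Type*} {G : SimpleGraph V} (h : IsUniformGraph G) :
    ∃ D, 1 < D ∧ DegreeLT G D := by
  obtain ⟨μ, hμ⟩ := h
  exact ⟨μ + 2, by omega, fun v => (hμ v).trans_lt (by exact_mod_cast (by omega : μ < μ + 2))⟩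

theorem DegreeLT.finite_neighborSet {V : Type*} {G : SimpleGraph V} {D : ℕ} (hD : DegreeLT G D)
    (v : V) : (G.neighborSet v).Finite :=
  finite_of_encard_le_coe (hD v).le

theorem succ_le_dist_of_lt {V : Type*} [MetricSpace V] (G : SimpleGraph V) [IsGraphMetric G]
    {u v : V} {n : ℕ} (h : n < dist u v) : (n + 1 : ℕ) ≤ dist u v := by
  rw [IsGraphMetric.dist_eq (G := G)] at h ⊢
  exact_mod_cast h

theorem exists_vertex_between {V : Type*} [MetricSpace V] (G : SimpleGraph V) [IsGraphMetric G]
    {u v : V} {n : ℕ} (hn : n ≤ dist u v) :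
    ∃ w, dist u w = n ∧ dist u w + dist w v = dist u v := by
  rcases n.eq_zero_or_pos with rfl | hpos
  · exact ⟨u, by simp⟩
  rw [IsGraphMetric.dist_eq (G := G), Nat.cast_le] at hn
  obtain ⟨p, hp⟩ := (SimpleGraph.Reachable.of_dist_ne_zero
    (hpos.trans_le hn).ne').exists_walk_length_eq_dist
  have htake := (SimpleGraph.dist_le (p.take n)).trans (p.take_length n).le
  have hdrop := (SimpleGraph.dist_le (p.drop n)).trans (p.drop_length n).le
  have htriangle := dist_triangle u (p.getVert n) v
  refine ⟨p.getVert n, ?_⟩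
  simp only [IsGraphMetric.dist_eq (G := G)] at htriangle ⊢
  norm_cast at htriangle ⊢
  omega

section GraphMetric

variable {V : Type*} [MetricSpace V] (G : SimpleGraph V) [IsGraphMetric G]

theorem dist_eq_one_iff_adj {u v : V} : dist u v = 1 ↔ G.Adj u v := by
  rw [IsGraphMetric.dist_eq (G := G), Nat.cast_eq_one, SimpleGraph.dist_eq_one_iff_adj]

theorem closedBall_succ_subset (v : V) (n : ℕ) :
    Metric.closedBall v (n + 1 : ℕ) ⊆ ⋃ w ∈ Metric.closedBall v n, insert w (G.neighborSet w) := by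
  intro u hu
  rw [Metric.mem_closedBall, dist_comm] at hu
  rw [mem_iUnion₂]
  rcases le_or_gt (dist v u) n with h | h
  · exact ⟨u, Metric.mem_closedBall'.2 h, mem_insert _ _⟩
  obtain ⟨w, hw, hwu⟩ := exists_vertex_between G h.le
  refine ⟨w, Metric.mem_closedBall'.2 hw.le, Or.inr ((dist_eq_one_iff_adj G).1 ?_)⟩
  have := succ_le_dist_of_lt G h
  push_cast at hu this
  linarith

variable {G} {D : ℕ}

theorem DegreeLT.encard_closedBall_le (hD : DegreeLT G D) (v : V) (n : ℕ) :
    (Metric.closedBall v n).encard ≤ (D ^ n : ℕ) := by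
  induction n with
  | zero => simp
  | succ n ih =>
    have hfin : (Metric.closedBall v (n : ℝ)).Finite := finite_of_encard_le_coe ih
    rw [← hfin.coe_toFinset, encard_coe_eq_coe_finsetCard] at ih
    calc (Metric.closedBall v ((n + 1 : ℕ) : ℝ)).encard
        ≤ (⋃ w ∈ hfin.toFinset, insert w (G.neighborSet w)).encard := by
          simpa using encard_le_encard (closedBall_succ_subset G v n)
      _ ≤ ∑ w ∈ hfin.toFinset, (insert w (G.neighborSet w)).encard :=
          Finset.set_encard_biUnion_le _ _
      _ ≤ ∑ _w ∈ hfin.toFinset, (D : ℕ∞) := Finset.sum_le_sum fun w _ =>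
          (encard_insert_le _ _).trans (Order.add_one_le_of_lt (hD w))
      _ ≤ (D ^ (n + 1) : ℕ) := by
          rw [Finset.sum_const, nsmul_eq_mul, pow_succ, Nat.cast_mul]
          gcongr

theorem DegreeLT.finite_closedBall (hD : DegreeLT G D) (v : V) (r : ℝ) :
    (Metric.closedBall v r).Finite := by
  obtain ⟨n, hn⟩ := exists_nat_ge r
  exact (finite_of_encard_le_coe (hD.encard_closedBall_le v n)).subset
    (Metric.closedBall_subset_closedBall hn)

theorem DegreeLT.ncard_closedBall_le (hD : DegreeLT G D) (v : V) (n : ℕ) :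
    (Metric.closedBall v n).ncard ≤ D ^ n :=
  (encard_le_coe_iff_finite_ncard_le.1 (hD.encard_closedBall_le v n)).2

/-- The inductive step of König's lemma. -/
theorem exists_adj_infinite_beyond (hfin : ∀ v, (G.neighborSet v).Finite) {o v : V} {Z : Set V}
    (hv : {y ∈ Z | dist o y = dist o v + dist v y}.Infinite) :
    ∃ w, G.Adj v w ∧ dist o w = dist o v + 1 ∧
      {y ∈ Z | dist o y = dist o w + dist w y}.Infinite := by
  by_contra! hcon
  refine hv (((finite_singleton v).union (((hfin v).subset (sep_subset _ fun w =>
    dist o w = dist o v + 1)).biUnion fun w hw => hcon w hw.1 hw.2)).subset ?_)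
  rintro y ⟨hyZ, hy⟩
  rcases eq_or_ne v y with rfl | hne
  · exact Or.inl rfl
  obtain ⟨w, hvw, hwy⟩ := exists_vertex_between G
    (succ_le_dist_of_lt G (n := 0) (by simpa using hne))
  rw [zero_add, Nat.cast_one] at hvw
  have h₁ := dist_triangle o v w
  have h₂ := dist_triangle o w y
  exact Or.inr (mem_biUnion (x := w) ⟨(dist_eq_one_iff_adj G).1 hvw, by linarith⟩
    ⟨hyZ, by linarith⟩)

theorem exists_ray (hfin : ∀ v, (G.neighborSet v).Finite) (o : V) {Z : Set V} (hZ : Z.Infinite) :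
    ∃ f : ℕ → V, f 0 = o ∧ Isometry f ∧
      ∀ n, {y ∈ Z | dist o y = dist o (f n) + dist (f n) y}.Infinite := by
  let S := {v // {y ∈ Z | dist o y = dist o v + dist v y}.Infinite}
  have hnext (v : S) : ∃ w : S, G.Adj v w ∧ dist o w.1 = dist o v.1 + 1 := by
    obtain ⟨w, hadj, hdist, hw⟩ := exists_adj_infinite_beyond hfin v.2
    exact ⟨⟨w, hw⟩, hadj, hdist⟩
  choose next hadj hdist using hnext
  let f (n : ℕ) : S := next^[n] ⟨o, by simpa using hZ⟩
  have hf (n : ℕ) : f (n + 1) = next (f n) := Function.iterate_succ_apply' _ _ _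
  have hdist_f (n : ℕ) : dist o (f n).1 = n := by
    induction n with
    | zero => simp [f]
    | succ n ih => rw [hf, hdist, ih, Nat.cast_succ]
  refine ⟨fun n => f n, rfl, isometry_of_dist_succ_le (fun n => ?_) fun n => (hdist_f n).ge,
    fun n => (f n).2⟩
  rw [hf]
  exact ((dist_eq_one_iff_adj G).2 (hadj _)).le

end GraphMetric

/-! ### The isoperimetric inequality -/

section Isoperimetry

variable {V : Type*} {G : SimpleGraph V}

theorem mem_vertexBoundary {A : Set V} {v : V} :
    v ∈ vertexBoundary G A ↔ v ∉ A ∧ ∃ a ∈ A, G.Adj v a := by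
  rw [vertexBoundary, mem_ofPred_eq]
  constructor
  · intro h
    have hone : ∀ a ∈ A, 1 ≤ G.edist v a := fun a ha => h ▸ iInf₂_le a ha
    refine ⟨fun hv => by simpa using hone v hv, ?_⟩
    by_contra! hadj
    have htwo : (2 : ℕ∞) ≤ ⨅ a ∈ A, G.edist v a := le_iInf₂ fun a ha =>
      Order.add_one_le_of_lt <| (hone a ha).lt_of_ne fun h =>
        hadj a ha (SimpleGraph.edist_eq_one_iff_adj.1 h.symm)
    rw [h] at htwo
    exact absurd htwo (by decide)
  · rintro ⟨hv, a, ha, hadj⟩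
    refine le_antisymm ((iInf₂_le a ha).trans (SimpleGraph.edist_eq_one_iff_adj.2 hadj).le)
      (le_iInf₂ fun b hb => ?_)
    rw [Order.one_le_iff_pos]
    exact SimpleGraph.edist_pos_of_ne fun h => hv (h ▸ hb)

theorem finite_vertexBoundary (hfin : ∀ v, (G.neighborSet v).Finite) {A : Set V} (hA : A.Finite) :
    (vertexBoundary G A).Finite :=
  (hA.biUnion fun a _ => hfin a).subset fun _ hv =>
    let ⟨_, _, ha, hadj⟩ := mem_vertexBoundary.1 hv
    mem_biUnion ha hadj.symm

/-- The isoperimetric inequality `h |A| ≤ |∂A|`. -/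
def HasIsoperimetry (G : SimpleGraph V) (h : ℝ) : Prop :=
  ∀ A : Finset V, h * A.card ≤ (vertexBoundary G (A : Set V)).ncard

theorem ofReal_le_encard_div_card_iff (hfin : ∀ v, (G.neighborSet v).Finite) {A : Finset V}
    (hA : A.Nonempty) {h : ℝ} (h0 : 0 ≤ h) :
    ENNReal.ofReal h ≤ ((vertexBoundary G (A : Set V)).encard : ℝ≥0∞) / (A.card : ℝ≥0∞) ↔
      h * A.card ≤ (vertexBoundary G (A : Set V)).ncard := by
  have hcard : (A.card : ℝ≥0∞) ≠ 0 := by simpa using hA.ne_empty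
  rw [ENNReal.le_div_iff_mul_le (Or.inl hcard) (Or.inl (ENNReal.natCast_ne_top _)),
    ← (finite_vertexBoundary hfin A.finite_toSet).cast_ncard_eq, ENat.toENNReal_coe,
    ← ENNReal.ofReal_natCast, ← ENNReal.ofReal_natCast, ← ENNReal.ofReal_mul h0,
    ENNReal.ofReal_le_ofReal_iff (Nat.cast_nonneg _)]

theorem cheegerConstant_pos_iff (hfin : ∀ v, (G.neighborSet v).Finite) :
    0 < cheegerConstant G ↔ ∃ h : ℝ, 0 < h ∧ HasIsoperimetry G h := by
  constructor
  · intro hpos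
    obtain ⟨h, -, h0, hlt⟩ := ENNReal.lt_iff_exists_real_btwn.1 hpos
    refine ⟨h, ENNReal.ofReal_pos.1 h0, fun A => ?_⟩
    rcases A.eq_empty_or_nonempty with rfl | hA
    · simp
    · exact (ofReal_le_encard_div_card_iff hfin hA (ENNReal.ofReal_pos.1 h0).le).1
        (hlt.le.trans (iInf₂_le A hA))
  · rintro ⟨h, h0, hG⟩
    exact (ENNReal.ofReal_pos.2 h0).trans_le <| le_iInf₂ fun A hA =>
      (ofReal_le_encard_div_card_iff hfin hA h0.le).2 (hG A)

theorem HasIsoperimetry.infinite [Nonempty V] {h : ℝ} (h0 : 0 < h) (hG : HasIsoperimetry G h) :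
    Infinite V := by
  by_contra hfin
  have := not_infinite_iff_finite.1 hfin
  have := Fintype.ofFinite V
  have hempty : vertexBoundary G ((Finset.univ : Finset V) : Set V) = ∅ :=
    eq_empty_of_forall_notMem fun v hv => (mem_vertexBoundary.1 hv).1 (by simp)
  have huniv := hG Finset.univ
  rw [hempty, ncard_empty, Nat.cast_zero] at huniv
  exact huniv.not_gt (mul_pos h0 (by simp [Fintype.card_pos]))

theorem HasIsoperimetry.one_add_mul_ncard_le {h : ℝ} (hG : HasIsoperimetry G h) {A B W : Set V}
    (hAB : A ⊆ B) (hB : B.Finite) (hW : W.Finite)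
    (hadj : ∀ y ∈ A, ∀ z, G.Adj y z → z ∈ B ∪ W) :
    (1 + h) * A.ncard ≤ B.ncard + W.ncard := by
  have hA := hB.subset hAB
  have hiso := hG hA.toFinset
  rw [← ncard_eq_toFinset_card _ hA, Finite.coe_toFinset] at hiso
  have hsub : vertexBoundary G A ⊆ B \ A ∪ W := fun z hz => by
    obtain ⟨hzA, y, hy, hzy⟩ := mem_vertexBoundary.1 hz
    exact (hadj y hy z hzy.symm).imp (fun hzB => ⟨hzB, hzA⟩) id
  have hle : (vertexBoundary G A).ncard ≤ (B \ A).ncard + W.ncard :=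
    (ncard_le_ncard hsub (hB.sdiff.union hW)).trans (ncard_union_le _ _)
  have heq : (B \ A).ncard + A.ncard = B.ncard := ncard_sdiff_add_ncard_of_subset hAB hB
  rify at hle heq
  linarith

end Isoperimetry

/-! ### Blow-up in finite time -/

section BlowUp

variable {h x κ D E : ℝ} {N : ℝ → ℝ}

theorem pow_mul_le_of_growth {e η θ : ℝ} (hh : 0 < h) (hη : 0 ≤ η)
    (hstep : ∀ θ ≤ 1, 1 / 2 ≤ θ - η → (1 + h) * N θ ≤ N (θ - η) + e) (hθ : θ ≤ 1)
    (hN : 0 ≤ N θ) (he : e ≤ h / 2 * N θ) (i : ℕ) (hi : 1 / 2 ≤ θ - i * η) :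
    (1 + h / 2) ^ i * N θ ≤ N (θ - i * η) := by
  induction i with
  | zero => simp
  | succ i ih =>
    have hsucc : θ - (i + 1 : ℕ) * η = θ - i * η - η := by push_cast; ring
    rw [hsucc] at hi ⊢
    have ih := ih (by linarith)
    have hmono : N θ ≤ N (θ - i * η) :=
      (le_mul_of_one_le_left hN (one_le_pow₀ (by linarith))).trans ih
    calc (1 + h / 2) ^ (i + 1) * N θ = (1 + h / 2) * ((1 + h / 2) ^ i * N θ) := by ring
      _ ≤ (1 + h / 2) * N (θ - i * η) := by gcongr
      _ = (1 + h) * N (θ - i * η) - h / 2 * N (θ - i * η) := by ring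
      _ ≤ (1 + h) * N (θ - i * η) - h / 2 * N θ := by gcongr
      _ ≤ N (θ - i * η - η) := by
        have := hstep (θ - i * η) (by nlinarith [mul_nonneg i.cast_nonneg hη]) hi
        linarith

theorem pow_mul_le_of_growth_of_pow_le {s L₀ : ℕ} (hh : 0 < h) (hx0 : 0 < x) (hx1 : x < 1)
    (hκ : 0 ≤ κ) (hD : 0 ≤ D) (hanti : AntitoneOn N (Icc (1 / 2) 1))
    (hstep : ∀ (L : ℕ), ∀ θ ≤ 1, 1 / 2 ≤ θ - κ * x ^ L →
      (1 + h) * N θ ≤ N (θ - κ * x ^ L) + E * D ^ L)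
    (hs : D ≤ (1 + h / 2) ^ s) (hL₀ : s * κ * x ^ L₀ ≤ (1 - x) / 2)
    (hN : 0 ≤ N 1) (hE : E * D ^ L₀ ≤ h / 2 * N 1) (j : ℕ) :
    D ^ j * N 1 ≤ N (1 / 2 + x ^ j / 2) := by
  induction j with
  | zero => norm_num
  | succ j ih =>
    set θ := 1 / 2 + x ^ j / 2
    have hNθ : 0 ≤ N θ := (mul_nonneg (pow_nonneg hD j) hN).trans ih
    have hxj : x ^ j ≤ 1 := pow_le_one₀ hx0.le hx1.le
    have hxj' := pow_pos hx0 (j + 1)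
    have herror : E * D ^ (L₀ + j) ≤ h / 2 * N θ :=
      calc E * D ^ (L₀ + j) = D ^ j * (E * D ^ L₀) := by ring
        _ ≤ D ^ j * (h / 2 * N 1) := by gcongr
        _ = h / 2 * (D ^ j * N 1) := by ring
        _ ≤ h / 2 * N θ := by gcongr
    have hdrop : 1 / 2 + x ^ (j + 1) / 2 ≤ θ - s * (κ * x ^ (L₀ + j)) :=
      calc 1 / 2 + x ^ (j + 1) / 2 = θ - (1 - x) / 2 * x ^ j := by simp only [θ]; ring
        _ ≤ θ - s * κ * x ^ L₀ * x ^ j := by gcongr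
        _ = θ - s * (κ * x ^ (L₀ + j)) := by ring
    have hdrop_nonneg : 0 ≤ s * (κ * x ^ (L₀ + j)) := by positivity
    calc D ^ (j + 1) * N 1 = D * (D ^ j * N 1) := by ring
      _ ≤ (1 + h / 2) ^ s * N θ := by gcongr
      _ ≤ N (θ - s * (κ * x ^ (L₀ + j))) :=
        pow_mul_le_of_growth hh (by positivity) (hstep (L₀ + j)) (by simp only [θ]; linarith)
          hNθ herror s (by linarith)
      _ ≤ N (1 / 2 + x ^ (j + 1) / 2) :=
        hanti ⟨by linarith, hdrop.trans (by simp only [θ]; linarith)⟩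
          ⟨by linarith, by simp only [θ]; linarith⟩ hdrop

/-- Applying the growth condition with `L = L₀ + j` a fixed number `s` of times multiplies `N` by
`D`, which compensates the increase of the error term. The levels consumed by these stages form a
convergent geometric series, so that `N (1 / 2)` would have to be infinite if `N 1` were large. -/
theorem exists_le_mul_of_growth (hh : 0 < h) (hx0 : 0 < x) (hx1 : x < 1) (hκ : 0 ≤ κ)
    (hD : 1 < D) : ∃ C > 0, ∀ E ≥ 0, ∀ N : ℝ → ℝ, AntitoneOn N (Icc (1 / 2) 1) →
      (∀ (L : ℕ), ∀ θ ≤ 1, 1 / 2 ≤ θ - κ * x ^ L →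
        (1 + h) * N θ ≤ N (θ - κ * x ^ L) + E * D ^ L) →
      N 1 ≤ C * E := by
  obtain ⟨s, hs⟩ := pow_unbounded_of_one_lt D (by linarith : 1 < 1 + h / 2)
  obtain ⟨L₀, hL₀⟩ : ∃ L₀ : ℕ, s * κ * x ^ L₀ < (1 - x) / 2 := by
    have := (tendsto_pow_atTop_nhds_zero_of_lt_one hx0.le hx1).const_mul (s * κ)
    rw [mul_zero] at this
    exact (this.eventually_lt_const (by linarith)).exists
  refine ⟨2 / h * D ^ L₀, by positivity, fun E hE N hanti hstep => ?_⟩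
  by_contra! hlarge
  have hN : 0 < N 1 := lt_of_le_of_lt (by positivity) hlarge
  have herror : E * D ^ L₀ ≤ h / 2 * N 1 :=
    calc E * D ^ L₀ = h / 2 * (2 / h * D ^ L₀ * E) := by field_simp
      _ ≤ h / 2 * N 1 := by gcongr
  obtain ⟨j, hj⟩ := pow_unbounded_of_one_lt (N (1 / 2) / N 1) hD
  rw [div_lt_iff₀ hN] at hj
  have hxj := pow_pos hx0 j
  have hxj' : x ^ j ≤ 1 := pow_le_one₀ hx0.le hx1.le
  exact (hj.trans_le (pow_mul_le_of_growth_of_pow_le hh hx0 hx1 hκ (by linarith) hanti hstep hs.le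
    hL₀.le hN.le herror j)).not_ge
    (hanti ⟨le_rfl, by norm_num⟩ ⟨by linarith, by linarith⟩ (by linarith))

end BlowUp

theorem exists_linear_lt_pow {r : ℝ} (hr : 1 < r) (K : ℝ) : ∃ k : ℕ, K * (k + 1) < r ^ k := by
  have hlim := (((tendsto_pow_const_div_const_pow_of_one_lt 1 hr).add
    (tendsto_pow_const_div_const_pow_of_one_lt 0 hr)).const_mul K).eventually_lt_const
    (by norm_num : K * (0 + 0) < 1)
  obtain ⟨k, hk⟩ := hlim.exists
  refine ⟨k, ?_⟩
  rwa [pow_one, pow_zero, ← add_div, ← mul_div_assoc, div_lt_one (by positivity)] at hk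

/-! ### Many directions at every vertex -/

namespace IsVisualDistance

variable {X : Type*} [MetricSpace X] {a : ℝ} {p x y z : X} {F : X → ℝ}

theorem gromovProduct_lt (hF : IsVisualDistance a p x F) (ha : 1 < a) {t : ℝ}
    (hy : a ^ (-t) < F y) : gromovProduct p y x < t :=
  neg_lt_neg_iff.1 ((Real.rpow_lt_rpow_left_iff ha).1 (hy.trans_le (hF.le_rpow y)))

theorem le_two_mul_mul (hF : IsVisualDistance a p x F) (ha : 1 < a) (hyz : dist y z ≤ 1) :
    F y ≤ 2 * a * F z := by
  have hprod := gromovProduct_le_add_dist_left p z x y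
  rw [dist_comm] at hprod
  calc F y ≤ a ^ (-gromovProduct p y x) := hF.le_rpow y
    _ ≤ a ^ (1 + -gromovProduct p z x) :=
      Real.rpow_le_rpow_of_exponent_le ha.le (by linarith)
    _ = a * a ^ (-gromovProduct p z x) := by
      rw [Real.rpow_add (by linarith), Real.rpow_one]
    _ ≤ a * (2 * F z) := by gcongr; exact hF.rpow_le z
    _ = 2 * a * F z := by ring

theorem one_sub_mul_le (hF : IsVisualDistance a p x F) (ha : 1 < a) (hyz : dist y z ≤ 1) {L : ℕ}
    (hL : gromovProduct p y x + L < dist p y) :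
    (1 - 2 * a * a⁻¹ ^ L) * F y ≤ F z := by
  have hprod := gromovProduct_le_add_dist_right p y y z
  rw [gromovProduct_self, dist_comm y p] at hprod
  have hyz : a ^ (-gromovProduct p y z) ≤ 2 * a * a⁻¹ ^ L * F y :=
    calc a ^ (-gromovProduct p y z) ≤ a ^ (1 + -(L : ℝ) + -gromovProduct p y x) :=
          Real.rpow_le_rpow_of_exponent_le ha.le (by linarith)
      _ = a * a⁻¹ ^ L * a ^ (-gromovProduct p y x) := by
          rw [Real.rpow_add (by linarith), Real.rpow_add (by linarith), Real.rpow_one,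
            Real.rpow_neg (by linarith), Real.rpow_natCast, inv_pow]
      _ ≤ a * a⁻¹ ^ L * (2 * F y) := by gcongr; exact hF.rpow_le y
      _ = 2 * a * a⁻¹ ^ L * F y := by ring
  linarith [hF.le_add y z]

end IsVisualDistance

section Directions

/-- The common superlevel set of the functions `F x` for `x ∈ S`. -/
def superlevel {V : Type*} (F : V → V → ℝ) (S : Finset V) (θ : ℝ) : Set V :=
  {y | ∀ x ∈ S, θ < F x y}

theorem superlevel_antitone {V : Type*} (F : V → V → ℝ) (S : Finset V) :
    Antitone (superlevel F S) :=
  fun _ _ hθ _ hy x hx => hθ.trans_lt (hy x hx)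

variable {V : Type*} [MetricSpace V] {G : SimpleGraph V} {δ : ℝ} {D c : ℕ}

/-- The vertices at distance about `L` from the part of a geodesic from `p` to `x` that consists of
its first `T` edges. The distance is encoded by Gromov products. -/
def nearGeodesic (p x : V) (T L : ℕ) : Set V :=
  {y | gromovProduct p y x ≤ T ∧ dist p y ≤ gromovProduct p y x + L}

theorem encard_neighborSet_nearGeodesic_le [IsGraphMetric G] (hδ : DeltaInequality V δ)
    (hD : DegreeLT G D) (hc : 2 * δ + 2 ≤ c) (p x : V) (T L : ℕ) :
    (⋃ y ∈ nearGeodesic p x T L, G.neighborSet y).encard ≤ ((T + 1) * D ^ (L + c) : ℕ) := by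
  have hgeodesic (n : ℕ) : ∃ w, n ≤ dist p x → dist p w = n ∧ dist p w + dist w x = dist p x := by
    by_cases hn : n ≤ dist p x
    · exact (exists_vertex_between G hn).imp fun w hw _ => hw
    · exact ⟨p, fun h => absurd h hn⟩
  choose g hg using hgeodesic
  have hsub : ⋃ y ∈ nearGeodesic p x T L, G.neighborSet y ⊆
      ⋃ n ∈ Finset.range (T + 1), Metric.closedBall (g n) ((L + c : ℕ) : ℝ) := by
    refine iUnion₂_subset fun y ⟨hT, hL⟩ z hadj => ?_
    have hfloor := Nat.floor_le (gromovProduct_nonneg p y x)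
    have hfloor' := Nat.lt_floor_add_one (gromovProduct p y x)
    have hright := gromovProduct_le_dist_right p y x
    rw [dist_comm] at hright
    obtain ⟨hpw, hw⟩ := hg ⌊gromovProduct p y x⌋₊ (hfloor.trans hright)
    have hyw := hδ.dist_le_of_between hw hpw.ge hfloor
    have htriangle := dist_triangle_left z (g ⌊gromovProduct p y x⌋₊) y
    rw [(dist_eq_one_iff_adj G).2 hadj] at htriangle
    refine mem_biUnion (Finset.mem_coe.2 (Finset.mem_range_succ_iff.2
      (Nat.floor_le_of_le hT))) (Metric.mem_closedBall.2 ?_)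
    push_cast
    linarith
  calc (⋃ y ∈ nearGeodesic p x T L, G.neighborSet y).encard
      ≤ ∑ n ∈ Finset.range (T + 1), (Metric.closedBall (g n) ((L + c : ℕ) : ℝ)).encard :=
        (encard_le_encard hsub).trans (Finset.set_encard_biUnion_le _ _)
    _ ≤ ∑ _n ∈ Finset.range (T + 1), ((D ^ (L + c) : ℕ) : ℕ∞) :=
        Finset.sum_le_sum fun n _ => hD.encard_closedBall_le (g n) (L + c)
    _ = ((T + 1) * D ^ (L + c) : ℕ) := by
        rw [Finset.sum_const, Finset.card_range, nsmul_eq_mul, Nat.cast_mul]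

theorem encard_iUnion_neighborSet_nearGeodesic_le [IsGraphMetric G] (hδ : DeltaInequality V δ)
    (hD : DegreeLT G D) (hc : 2 * δ + 2 ≤ c) (p : V) (S : Finset V) (T L : ℕ) :
    (⋃ x ∈ S, ⋃ y ∈ nearGeodesic p x T L, G.neighborSet y).encard ≤
      (S.card * ((T + 1) * D ^ (L + c)) : ℕ) :=
  (Finset.set_encard_biUnion_le _ _).trans <|
    (Finset.sum_le_sum fun x _ => encard_neighborSet_nearGeodesic_le hδ hD hc p x T L).trans
      (by rw [Finset.sum_const, nsmul_eq_mul, Nat.cast_mul S.card])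

variable {a h Θ : ℝ} {p : V} {F : V → V → ℝ} {S : Finset V}

theorem one_add_pow_le_ncard_superlevel [IsGraphMetric G] (ha : 1 < a) (hh : 0 < h)
    (hiso : HasIsoperimetry G h) (hF : ∀ x ∈ S, IsVisualDistance a p x (F x)) (k : ℕ)
    (hfin : (superlevel F S (1 / 4 * (2 * a)⁻¹ ^ k)).Finite) :
    (1 + h) ^ k ≤ (superlevel F S (1 / 4 * (2 * a)⁻¹ ^ k)).ncard := by
  induction k with
  | zero =>
    have hp : p ∈ superlevel F S (1 / 4 * (2 * a)⁻¹ ^ 0) := fun x hx => by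
      have hge := (hF x hx).rpow_le p
      have hzero : gromovProduct p p x = 0 :=
        le_antisymm ((gromovProduct_le_dist_left p p x).trans (dist_self p).le)
          (gromovProduct_nonneg p p x)
      rw [hzero, neg_zero, Real.rpow_zero] at hge
      rw [pow_zero]
      linarith
    rw [pow_zero, Nat.one_le_cast]
    exact (ncard_pos hfin).2 ⟨p, hp⟩
  | succ k ih =>
    have hinv : (2 * a)⁻¹ ≤ 1 := inv_le_one_of_one_le₀ (by linarith)
    have hsub : superlevel F S (1 / 4 * (2 * a)⁻¹ ^ k) ⊆
        superlevel F S (1 / 4 * (2 * a)⁻¹ ^ (k + 1)) := superlevel_antitone F S <|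
      mul_le_mul_of_nonneg_left (pow_le_pow_of_le_one (by positivity) hinv k.le_succ) (by norm_num)
    have hgrowth := hiso.one_add_mul_ncard_le hsub hfin finite_empty fun y hy z hadj =>
      Or.inl fun x hx => by
        have hyz := (hF x hx).le_two_mul_mul ha ((dist_eq_one_iff_adj G).2 hadj).le
        rw [pow_succ, ← mul_assoc, ← div_eq_mul_inv, div_lt_iff₀ (by linarith)]
        linarith [hy x hx]
    rw [ncard_empty, Nat.cast_zero, add_zero] at hgrowth
    calc (1 + h) ^ (k + 1) = (1 + h) * (1 + h) ^ k := pow_succ' _ _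
      _ ≤ (1 + h) * (superlevel F S (1 / 4 * (2 * a)⁻¹ ^ k)).ncard := by
        gcongr; exact ih (hfin.subset hsub)
      _ ≤ _ := hgrowth

theorem one_add_mul_ncard_superlevel_le [IsGraphMetric G] (hδ : DeltaInequality V δ)
    (hD : DegreeLT G D) (hc : 2 * δ + 2 ≤ c) (ha : 1 < a) (hiso : HasIsoperimetry G h)
    (hF : ∀ x ∈ S, IsVisualDistance a p x (F x)) {T : ℕ} (hT : a ^ (-(T : ℝ)) ≤ Θ / 2)
    (hfin : (superlevel F S (Θ / 2)).Finite) (L : ℕ) {θ : ℝ} (hθ : θ ≤ 1)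
    (hL : 1 / 2 ≤ θ - 2 * a * a⁻¹ ^ L) :
    (1 + h) * (superlevel F S (Θ * θ)).ncard ≤
      (superlevel F S (Θ * (θ - 2 * a * a⁻¹ ^ L))).ncard + S.card * (T + 1) * D ^ c * D ^ L := by
  set η := 2 * a * a⁻¹ ^ L
  have hη : 0 ≤ η := by positivity
  have hΘ : 0 < Θ := by
    have : 0 < a ^ (-(T : ℝ)) := by positivity
    linarith
  have hW := encard_iUnion_neighborSet_nearGeodesic_le hδ hD hc p S T L
  obtain ⟨hWfin, hWcard⟩ := encard_le_coe_iff_finite_ncard_le.1 hW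
  have hgrowth := hiso.one_add_mul_ncard_le
    (superlevel_antitone F S (mul_le_mul_of_nonneg_left (sub_le_self θ hη) hΘ.le))
    (hfin.subset (superlevel_antitone F S (by nlinarith))) hWfin fun y hy z hadj => by
      by_cases hnear : ∃ x ∈ S, dist p y ≤ gromovProduct p y x + L
      · obtain ⟨x, hx, hyx⟩ := hnear
        have hprod := (hF x hx).gromovProduct_lt (t := T) ha
          (hT.trans_lt (lt_of_le_of_lt (by nlinarith) (hy x hx)))
        exact Or.inr (mem_biUnion hx (mem_biUnion (x := y) ⟨hprod.le, hyx⟩ hadj))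
      · push Not at hnear
        refine Or.inl fun x hx => ?_
        calc Θ * (θ - η) ≤ (1 - η) * (Θ * θ) := by
              nlinarith [mul_nonneg (mul_nonneg hΘ.le hη) (sub_nonneg.2 hθ)]
          _ < (1 - η) * F x y := mul_lt_mul_of_pos_left (hy x hx) (by linarith)
          _ ≤ F x z := (hF x hx).one_sub_mul_le ha ((dist_eq_one_iff_adj G).2 hadj).le (hnear x hx)
  have hcard : ((⋃ x ∈ S, ⋃ y ∈ nearGeodesic p x T L, G.neighborSet y).ncard : ℝ) ≤
      S.card * ((T + 1) * D ^ (L + c)) := by exact_mod_cast hWcard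
  calc _ ≤ _ := hgrowth
    _ ≤ _ := add_le_add_right hcard _
    _ = _ := by rw [pow_add]; ring

theorem rpow_neg_mul_succ_le (ha : 1 < a) {s : ℕ} (hs : max (2 * a) 8 ≤ a ^ s) (k : ℕ) :
    a ^ (-((s * (k + 1) : ℕ) : ℝ)) ≤ 1 / 4 * (2 * a)⁻¹ ^ k / 2 := by
  rw [Real.rpow_neg (by linarith), Real.rpow_natCast, pow_mul, pow_succ]
  calc ((a ^ s) ^ k * a ^ s)⁻¹ ≤ ((2 * a) ^ k * 8)⁻¹ := by
        gcongr
        exacts [(le_max_left _ _).trans hs, (le_max_right _ _).trans hs]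
    _ = 1 / 4 * (2 * a)⁻¹ ^ k / 2 := by rw [inv_pow]; field_simp; norm_num

/-- Superlevel sets of visual distances to the elements of `S` grow exponentially, as the level
decreases from `1 / 4` to some `Θ`. Below `Θ`, isoperimetry makes them infinite before the level
`Θ / 2` is reached. -/
theorem exists_infinite_directions [Nonempty V] [IsGraphMetric G] (hδ : DeltaInequality V δ)
    (hD : DegreeLT G D) (hD1 : 1 < D) (hh : 0 < h) (hiso : HasIsoperimetry G h) (m : ℕ) :
    ∃ T : ℕ, ∀ (p : V) (S : Finset V), S.card ≤ m →
      {y | ∀ x ∈ S, gromovProduct p y x ≤ T}.Infinite := by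
  obtain ⟨a, ha, haδ⟩ := exists_one_lt_rpow_two_mul_le_two (hδ.nonneg (Classical.arbitrary V))
  obtain ⟨c, hc⟩ := exists_nat_ge (2 * δ + 2)
  obtain ⟨C, hC, hblowup⟩ := exists_le_mul_of_growth (x := a⁻¹) (κ := 2 * a) (D := D) hh
    (by positivity) (inv_lt_one_of_one_lt₀ ha) (by positivity) (by exact_mod_cast hD1)
  obtain ⟨s, hs⟩ := pow_unbounded_of_one_lt (max (2 * a) 8) ha
  obtain ⟨k, hk⟩ := exists_linear_lt_pow (by linarith : 1 < 1 + h) (C * (m * (s + 1) * D ^ c))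
  set Θ : ℝ := 1 / 4 * (2 * a)⁻¹ ^ k
  have hΘ : 0 < Θ := by positivity
  have hT : a ^ (-((s * (k + 1) : ℕ) : ℝ)) ≤ Θ / 2 := rpow_neg_mul_succ_le ha hs.le k
  refine ⟨s * (k + 1), fun p S hS => ?_⟩
  choose F hF using hδ.exists_isVisualDistance ha haδ p
  suffices hinf : (superlevel F S (Θ / 2)).Infinite from
    hinf.mono fun y (hy : ∀ x ∈ S, Θ / 2 < F x y) x hx =>
      ((hF x).gromovProduct_lt ha (hT.trans_lt (hy x hx))).le
  intro hfin
  have hfin' {θ : ℝ} (hθ : 1 / 2 ≤ θ) : (superlevel F S (Θ * θ)).Finite :=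
    hfin.subset (superlevel_antitone F S (by nlinarith))
  have hbound := hblowup (S.card * ((s * (k + 1) : ℕ) + 1) * D ^ c) (by positivity)
    (fun θ => (superlevel F S (Θ * θ)).ncard)
    (fun θ hθ θ' _ hle => Nat.cast_le.2 <| ncard_le_ncard
      (superlevel_antitone F S (mul_le_mul_of_nonneg_left hle hΘ.le)) (hfin' hθ.1))
    fun L θ hθ hL => one_add_mul_ncard_superlevel_le hδ hD hc ha hiso (fun x _ => hF x) hT hfin L
      hθ hL
  have hexp := one_add_pow_le_ncard_superlevel ha hh hiso (fun x _ => hF x) k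
    (hfin.subset (superlevel_antitone F S (half_le_self hΘ.le)))
  rw [mul_one] at hbound
  have hS' : (S.card : ℝ) ≤ m := by exact_mod_cast hS
  refine hk.not_ge ((hexp.trans hbound).trans ?_)
  calc C * (S.card * ((s * (k + 1) : ℕ) + 1) * D ^ c)
      ≤ C * (m * ((s + 1) * (k + 1)) * D ^ c) := by
        gcongr
        push_cast
        linarith [k.cast_nonneg (α := ℝ)]
    _ = C * (m * (s + 1) * D ^ c) * (k + 1) := by ring

end Directions

/-! ### Isoperimetry yields rays in many directions -/

section Rays

variable {V : Type*} [MetricSpace V] {G : SimpleGraph V} [IsGraphMetric G] {δ T : ℝ} {o p x z : V}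

theorem exists_ray_dist_le (hδ : DeltaInequality V δ) (hfin : ∀ v, (G.neighborSet v).Finite)
    (hinf : {y | gromovProduct x y o ≤ T}.Infinite) :
    ∃ f : ℕ → V, f 0 = o ∧ Isometry f ∧ ∃ n, dist x (f n) ≤ 2 * T + 2 * δ := by
  obtain ⟨f, rfl, hf, hbeyond⟩ := exists_ray hfin o hinf
  refine ⟨f, rfl, hf, G.dist (f 0) x, ?_⟩
  obtain ⟨y, hy, hbetween⟩ := (hbeyond (G.dist (f 0) x)).nonempty
  have hT : gromovProduct x y (f 0) ≤ T := hy
  have hn := dist_ray_zero hf (G.dist (f 0) x)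
  rw [← IsGraphMetric.dist_eq] at hn
  have hxy := gromovProduct_add_gromovProduct (f 0) x y
  rw [gromovProduct_comm x] at hxy
  have := gromovProduct_nonneg x y (f 0)
  have := hδ.dist_le_of_between (s := dist (f 0) x - T) hbetween.symm (by linarith)
    (y := x) (by linarith)
  linarith

theorem exists_ray_gromovProduct_mem_Icc (hδ : DeltaInequality V δ)
    (hfin : ∀ v, (G.neighborSet v).Finite) (hp : dist o p + dist p z = dist o z)
    (hinf : {y | gromovProduct p y o ≤ T ∧ gromovProduct p y z ≤ T}.Infinite) :
    ∃ f : ℕ → V, Isometry f ∧ ∀ᶠ n in atTop,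
      gromovProduct o (f n) z ∈ Icc (dist o p - T - 2 * δ) (dist o p + T + δ) := by
  obtain ⟨f, rfl, hf, hbeyond⟩ := exists_ray hfin o hinf
  refine ⟨f, hf, ?_⟩
  filter_upwards [tendsto_natCast_atTop_atTop.eventually_gt_atTop (dist (f 0) p + T + δ)] with n hn
  obtain ⟨y, ⟨hyo, hyz⟩, hbetween⟩ := (hbeyond n).nonempty
  have hny : gromovProduct (f 0) (f n) y = n := by
    rw [gromovProduct_eq_dist_of_between hbetween.symm, dist_ray_zero hf]
  have hT : 0 ≤ T := (gromovProduct_nonneg _ _ _).trans hyo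
  have hδ₀ := hδ.nonneg p
  have hpy := gromovProduct_add_gromovProduct (f 0) p y
  rw [gromovProduct_comm p, gromovProduct_comm (f 0)] at hpy
  have hpz := gromovProduct_eq_dist_of_between hp
  have hlower := hδ.sub_le_gromovProduct (s := dist (f 0) p - T) (o := f 0) (x := y) (y := z)
    (z := p) (by linarith) (by linarith)
  have hupper := gromovProduct_le_add_dist_base (f 0) p y z
  constructor
  · have := hδ.sub_le_gromovProduct (s := dist (f 0) p - T - δ) (by linarith) hlower
    linarith
  · rw [gromovProduct_comm (f 0) (f n)] at hny
    have := hδ.gromovProduct_le_add (s := dist (f 0) p + T) (x := y) (y := z) (z := f n)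
      (by linarith) (by linarith)
    linarith

theorem isUniformlyBranching_of_infinite_directions (hδ : DeltaInequality V δ)
    (hfin : ∀ v, (G.neighborSet v).Finite)
    (hinf : ∀ p z, {y | gromovProduct p y o ≤ T ∧ gromovProduct p y z ≤ T}.Infinite) :
    IsUniformlyBranching V o := by
  have hT : 0 ≤ T := by
    obtain ⟨y, hy⟩ := (hinf o o).nonempty
    exact (gromovProduct_nonneg _ _ _).trans hy.1
  have hδ₀ := hδ.nonneg o
  refine ⟨0, 2 * T + 5 * δ + 1, fun x hx τ hτ => ?_⟩
  obtain ⟨n, hn⟩ : ∃ n : ℕ, n = ⌈τ + T + 3 * δ⌉₊ := ⟨_, rfl⟩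
  have hn_ge : τ + T + 3 * δ ≤ n := hn ▸ Nat.le_ceil _
  have hn_lt : n < τ + T + 3 * δ + 1 := hn ▸ Nat.ceil_lt_add_one (by positivity)
  obtain ⟨k, hk⟩ :=
    (eventually_atTop_curry ((hx o).eventually_gt_atTop (n + T + 2 * δ))).exists
  have hnk : n ≤ dist o (x k) := by
    obtain ⟨i, hi⟩ := hk.exists
    rw [dist_comm]
    linarith [gromovProduct_le_dist_left o (x k) (x i)]
  obtain ⟨p, hop, hp⟩ := exists_vertex_between G hnk
  obtain ⟨f, hf, hfk⟩ := exists_ray_gromovProduct_mem_Icc hδ hfin hp (hinf p (x k))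
  refine ⟨f, convergesToInfinity_ray hf, ?_⟩
  filter_upwards [hk, hfk] with i hi ⟨hlo, hhi⟩
  rw [hop, gromovProduct_comm] at hlo hhi
  have hupper := hδ.gromovProduct_le_add (z := x i) hhi (by linarith)
  rw [gromovProduct_comm] at hi
  have hlower := hδ.sub_le_gromovProduct (s := n - T - 2 * δ) (by linarith) hlo
  constructor <;> linarith

end Rays

/-! ### Visual spaces -/

/-- The space is visual from `o`: every point is close to a geodesic from `o` to a boundary point.
Here the boundary point is represented by a sequence, and closeness is expressed by Gromov
products. -/
def IsVisual (X : Type*) [MetricSpace X] (o : X) : Prop :=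
  ∃ M : ℝ, ∀ x, ∃ y : ℕ → X, ConvergesToInfinity y ∧
    ∀ᶠ n in atTop, dist o x - M ≤ gromovProduct o x (y n)

section Visual

variable {X Y : Type*} [MetricSpace X] [MetricSpace Y]

theorem IsVisual.change_base {o : X} (h : IsVisual X o) (o' : X) : IsVisual X o' := by
  obtain ⟨M, h⟩ := h
  refine ⟨M + 2 * dist o o', fun x => ?_⟩
  obtain ⟨y, hy, hxy⟩ := h x
  refine ⟨y, hy, hxy.mono fun n hn => ?_⟩
  have := gromovProduct_le_add_dist_base o o' x (y n)
  have := dist_triangle_left o' x o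
  linarith

theorem HasPole.exists_isVisual (h : HasPole X) : ∃ v : X, IsVisual X v := by
  obtain ⟨v, M, -, h⟩ := h
  refine ⟨v, 2 * M, fun x => ?_⟩
  obtain ⟨γ, hγ, rfl, t, ht⟩ := h x
  have hray : Isometry fun n : ℕ => γ n :=
    hγ.comp (Isometry.of_dist_eq fun m n => by simp [NNReal.dist_eq, Nat.dist_eq])
  refine ⟨_, convergesToInfinity_ray hray, ?_⟩
  filter_upwards [eventually_ge_atTop ⌈t⌉₊] with n hn
  have htn : (t : ℝ) ≤ n := Nat.ceil_le.1 hn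
  have hbetween : dist (γ 0) (γ t) + dist (γ t) (γ n) = dist (γ 0) (γ n) := by
    simp only [hγ.dist_eq, NNReal.dist_eq, NNReal.coe_zero, zero_sub, abs_neg, NNReal.abs_eq,
      NNReal.coe_natCast]
    rw [abs_sub_comm, abs_of_nonneg (sub_nonneg.2 htn)]
    simp
  have := gromovProduct_eq_dist_of_between hbetween
  have := gromovProduct_le_add_dist_left (γ 0) (γ t) (γ n) x
  have := dist_triangle_right (γ 0) x (γ t)
  rw [dist_comm (γ t) x] at *
  linarith

theorem IsVisual.of_isometry {f : X → Y} (hf : Isometry f) {c : ℝ}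
    (hc : ∀ y, ∃ x, dist y (f x) ≤ c) {o : X} (h : IsVisual Y (f o)) : IsVisual X o := by
  choose g hg using hc
  obtain ⟨M, h⟩ := h
  refine ⟨M + c, fun x => ?_⟩
  obtain ⟨y, hy, hxy⟩ := h (f x)
  refine ⟨g ∘ y, hy.of_dist_isometry_le hf o fun i => hg (y i), hxy.mono fun n hn => ?_⟩
  rw [hf.dist_eq] at hn
  rw [← gromovProduct_map hf, Function.comp_apply]
  linarith [gromovProduct_le_add_dist_right (f o) (f x) (y n) (f (g (y n))), hg (y n)]

end Visual

/-! ### Many descendants of every vertex -/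

section Descendants

theorem IsUniformlyBranching.exists_gromovProduct_lt {X : Type*} [MetricSpace X] {δ : ℝ} {o : X}
    (h : IsUniformlyBranching X o) (hδ : DeltaInequality X δ) (m : ℕ) :
    ∃ C : ℝ, ∀ w, ConvergesToInfinity w → ∀ s ≥ 0, ∀ r : ℝ, ∀ᶠ n in atTop, ∃ u : Fin m → X,
      (∀ j, s ≤ gromovProduct o (w n) (u j)) ∧ (∀ j, r ≤ dist o (u j)) ∧
        Pairwise fun i j => gromovProduct o (u i) (u j) < s + C := by
  obtain ⟨τ₀, σ, h⟩ := h
  have hδ₀ := hδ.nonneg o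
  set Δ : ℝ := |σ| + δ + 1
  refine ⟨|τ₀| + m * Δ, fun w hw s hs r => ?_⟩
  have hΔ (j : Fin m) : 0 ≤ j * Δ := by positivity
  choose y hy hwy using fun j : Fin m => h w hw (s + |τ₀| + j * Δ)
    (by linarith [hΔ j, le_abs_self τ₀])
  have hfar : ∀ᶠ n in atTop, ∀ j, r ≤ dist o (y j n) :=
    eventually_all.2 fun j => ((hy j).tendsto_dist o).eventually_ge_atTop r
  filter_upwards [eventually_all.2 hwy, hfar] with n hn hrn
  refine ⟨fun j => y j n, fun j => ?_, hrn, fun i j hij => ?_⟩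
  · linarith [(hn j).1, hΔ j, abs_nonneg τ₀]
  wlog hlt : i < j generalizing i j
  · rw [gromovProduct_comm]
    exact this j i hij.symm (hij.lt_or_gt.resolve_left hlt)
  have hsucc : ((i : ℝ) + 1) * Δ ≤ j * Δ := by
    gcongr
    exact_mod_cast hlt
  have hjm : (j : ℝ) * Δ ≤ m * Δ := by
    gcongr
    exact_mod_cast j.2.le
  have hσ := le_abs_self σ
  have hji := hδ.gromovProduct_le_add (z := y j n) (hn i).2 (by linarith [(hn j).1])
  rw [gromovProduct_comm]
  linarith

variable {V : Type*} [MetricSpace V] {δ : ℝ} {o : V}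

theorem exists_injective_dist_eq_add (G : SimpleGraph V) [IsGraphMetric G]
    (hδ : DeltaInequality V δ) (hvisual : IsVisual V o) (hbranch : IsUniformlyBranching V o) :
    ∃ M : ℝ, ∀ m : ℕ, ∃ R : ℕ, ∀ x, ∃ y : Fin m → V, Function.Injective y ∧
      ∀ j, dist o (y j) = dist o x + R ∧ dist o x - M ≤ gromovProduct o x (y j) := by
  obtain ⟨M, hvisual⟩ := hvisual
  refine ⟨M + 2 * δ, fun m => ?_⟩
  obtain ⟨C, hC⟩ := hbranch.exists_gromovProduct_lt hδ m
  obtain ⟨R, hR⟩ := exists_nat_ge C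
  refine ⟨R, fun x => ?_⟩
  obtain ⟨w, hw, hxw⟩ := hvisual x
  obtain ⟨n, hxn, u, hwu, hfar, hsep⟩ :=
    (hxw.and (hC w hw (dist o x) dist_nonneg (dist o x + R))).exists
  have hcut (j : Fin m) :
      ∃ y, dist o y = dist o x + R ∧ dist o y + dist y (u j) = dist o (u j) := by
    have hj := hfar j
    rw [IsGraphMetric.dist_eq (G := G) o x, ← Nat.cast_add] at hj ⊢
    exact exists_vertex_between G hj
  choose y hy hyu using hcut
  refine ⟨y, fun i j hij => ?_, fun j => ⟨hy j, ?_⟩⟩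
  · by_contra hne
    have hlow := dist_le_gromovProduct_of_between (hyu i) (hij ▸ hyu j)
    linarith [hsep hne, hy i]
  · have hMn := hxn.trans (gromovProduct_le_dist_left o x (w n))
    rw [dist_comm x o] at hMn
    have hxu := hδ.sub_le_gromovProduct hxn (by linarith [hwu j] : _ ≤ gromovProduct o (w n) (u j))
    have hδ₀ := hδ.nonneg o
    have hxy := hδ.sub_le_gromovProduct_of_between (hyu j)
      (by linarith [hy j, (Nat.cast_nonneg R : (0 : ℝ) ≤ R)]) hxu
    linarith

theorem exists_map_many_preimages (G : SimpleGraph V) [IsGraphMetric G]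
    (hδ : DeltaInequality V δ) (hvisual : IsVisual V o) (hbranch : IsUniformlyBranching V o) :
    ∃ c : ℝ, ∀ m : ℕ, ∃ (R : ℕ) (φ : V → V), (∀ y, dist y (φ y) ≤ R) ∧
      ∀ x, ∃ y : Fin m → V, Function.Injective y ∧ ∀ j, dist x (φ (y j)) ≤ c := by
  obtain ⟨M, hmany⟩ := exists_injective_dist_eq_add G hδ hvisual hbranch
  refine ⟨2 * M + 2 * δ, fun m => ?_⟩
  obtain ⟨R, hR⟩ := hmany m
  have hpred (y : V) : ∃ w, dist y w ≤ R ∧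
      (R ≤ dist y o → dist y w = R ∧ dist y w + dist w o = dist y o) := by
    by_cases hy : R ≤ dist y o
    · obtain ⟨w, hw, hbetween⟩ := exists_vertex_between G hy
      exact ⟨w, hw.le, fun _ => ⟨hw, hbetween⟩⟩
    · exact ⟨y, by simp, fun h => absurd h hy⟩
  choose φ hφ hbetween using hpred
  refine ⟨R, φ, hφ, fun x => ?_⟩
  obtain ⟨y, hinj, hy⟩ := hR x
  refine ⟨y, hinj, fun j => ?_⟩
  obtain ⟨hoy, hprod⟩ := hy j
  have hx : 0 ≤ dist o x := dist_nonneg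
  obtain ⟨hyφ, hadd⟩ := hbetween (y j) (by rw [dist_comm]; linarith)
  rw [dist_comm (φ (y j)) o, dist_comm (y j) o, dist_comm (y j)] at *
  have hM := hprod.trans (gromovProduct_le_dist_left o x (y j))
  rw [dist_comm x o] at hM
  have := hδ.dist_le_of_between (p := o) (w := φ (y j)) (x := y j) (y := x)
    (s := dist o x - M) (by linarith) (by linarith) hprod
  linarith

end Descendants

/-! ### Isoperimetry from many preimages -/

section Preimages

variable {V : Type*} [MetricSpace V] {G : SimpleGraph V} [IsGraphMetric G] {D : ℕ}

theorem exists_mem_vertexBoundary_dist_le {A : Finset V} {v y : V} (hv : v ∈ A) (hy : y ∉ A) :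
    ∃ b ∈ vertexBoundary G (A : Set V), dist b y ≤ dist v y := by
  obtain ⟨a, ha, hmin⟩ := A.exists_min_image (dist · y) ⟨v, hv⟩
  have hpos : ((0 : ℕ) : ℝ) < dist a y := by
    rw [Nat.cast_zero, dist_pos]
    exact fun h => hy (h ▸ ha)
  obtain ⟨b, hab, hby⟩ := exists_vertex_between G (succ_le_dist_of_lt G hpos)
  rw [zero_add, Nat.cast_one] at hab
  refine ⟨b, mem_vertexBoundary.2 ⟨fun hb => ?_, a, ha, ((dist_eq_one_iff_adj G).1 hab).symm⟩, ?_⟩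
  · linarith [hmin b hb]
  · linarith [hmin v hv]

theorem hasIsoperimetry_of_two_mul_card_le (hD : DegreeLT G D) (hD₀ : 0 < D) (n : ℕ)
    (hthick : ∀ A : Finset V, 2 * A.card ≤ (⋃ v ∈ A, Metric.closedBall v n).ncard) :
    HasIsoperimetry G ((D : ℝ) ^ n)⁻¹ := fun A => by
  have hbdry := finite_vertexBoundary hD.finite_neighborSet A.finite_toSet
  have hsub : ⋃ v ∈ A, Metric.closedBall v n ⊆
      A ∪ ⋃ b ∈ hbdry.toFinset, Metric.closedBall b n := by
    refine iUnion₂_subset fun v hv y hy => or_iff_not_imp_left.2 fun hyA => ?_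
    obtain ⟨b, hb, hby⟩ := exists_mem_vertexBoundary_dist_le (G := G) hv (Finset.mem_coe.not.1 hyA)
    rw [Metric.mem_closedBall'] at hy
    exact mem_biUnion (hbdry.mem_toFinset.2 hb) (Metric.mem_closedBall'.2 (hby.trans hy))
  have hfin : (⋃ b ∈ hbdry.toFinset, Metric.closedBall b (n : ℝ)).Finite :=
    hbdry.toFinset.finite_toSet.biUnion fun b _ => hD.finite_closedBall b n
  have hcard : 2 * A.card ≤ A.card + (vertexBoundary G (A : Set V)).ncard * D ^ n :=
    calc 2 * A.card ≤ (⋃ v ∈ A, Metric.closedBall v n).ncard := hthick A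
      _ ≤ (A : Set V).ncard + (⋃ b ∈ hbdry.toFinset, Metric.closedBall b n).ncard :=
        (ncard_le_ncard hsub (A.finite_toSet.union hfin)).trans (ncard_union_le _ _)
      _ ≤ A.card + ∑ b ∈ hbdry.toFinset, (Metric.closedBall b (n : ℝ)).ncard :=
        add_le_add (ncard_coe_finset A).le (Finset.set_ncard_biUnion_le _ _)
      _ ≤ A.card + hbdry.toFinset.card * D ^ n :=
        add_le_add_right (Finset.sum_le_card_nsmul _ _ _ fun b _ => hD.ncard_closedBall_le b n) _
      _ = _ := by rw [ncard_eq_toFinset_card _ hbdry]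
  rw [inv_mul_le_iff₀ (by positivity), mul_comm]
  exact_mod_cast (by omega : A.card ≤ (vertexBoundary G (A : Set V)).ncard * D ^ n)

theorem mul_card_le_ncard_of_preimages (hD : DegreeLT G D) (hD₀ : 0 < D) {m c R : ℕ} {φ : V → V}
    (hφ : ∀ y, dist y (φ y) ≤ R)
    (hmany : ∀ x, ∃ y : Fin (m * D ^ c) → V, Function.Injective y ∧ ∀ j, dist x (φ (y j)) ≤ c)
    (A : Finset V) : m * A.card ≤ (⋃ v ∈ A, Metric.closedBall v (c + R : ℕ)).ncard := by
  classical
  have hU : (⋃ v ∈ A, Metric.closedBall v (c + R : ℕ)).Finite :=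
    A.finite_toSet.biUnion fun v _ => hD.finite_closedBall v _
  rw [ncard_eq_toFinset_card _ hU]
  have hcount : A.card * (m * D ^ c) ≤ hU.toFinset.card * D ^ c := by
    refine Finset.card_mul_le_card_mul (fun x y => dist x (φ y) ≤ c) (fun x hx => ?_)
      fun y _ => ?_
    · obtain ⟨y, hinj, hy⟩ := hmany x
      rw [← Fintype.card_fin (m * D ^ c), ← Finset.card_univ]
      refine Finset.card_le_card_of_injOn y (fun j _ => ?_) hinj.injOn
      refine (Finset.mem_bipartiteAbove _).2 ⟨hU.mem_toFinset.2 (mem_biUnion hx ?_), hy j⟩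
      rw [Metric.mem_closedBall', Nat.cast_add]
      exact (dist_triangle_right _ _ _).trans (add_le_add (hy j) (hφ (y j)))
    · rw [← ncard_coe_finset]
      refine (ncard_le_ncard (fun x hx => ?_) (hD.finite_closedBall _ _)).trans
        (hD.ncard_closedBall_le (φ y) c)
      exact ((Finset.mem_bipartiteBelow _).1 (Finset.mem_coe.1 hx)).2
  refine Nat.le_of_mul_le_mul_right (c := D ^ c) ?_ (by positivity)
  linarith

theorem exists_hasIsoperimetry_of_isVisual_of_isUniformlyBranching {δ : ℝ} {o : V}
    (hδ : DeltaInequality V δ) (hD : DegreeLT G D) (hD₀ : 0 < D) (hvisual : IsVisual V o)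
    (hbranch : IsUniformlyBranching V o) : ∃ h : ℝ, 0 < h ∧ HasIsoperimetry G h := by
  obtain ⟨c, hc⟩ := exists_map_many_preimages G hδ hvisual hbranch
  obtain ⟨n, hn⟩ := exists_nat_ge c
  obtain ⟨R, φ, hφ, hmany⟩ := hc (2 * D ^ n)
  refine ⟨((D : ℝ) ^ (n + R))⁻¹, by positivity, hasIsoperimetry_of_two_mul_card_le hD hD₀ _ <|
    mul_card_le_ncard_of_preimages hD hD₀ hφ fun x => ?_⟩
  obtain ⟨y, hinj, hy⟩ := hmany x
  exact ⟨y, hinj, fun j => (hy j).trans hn⟩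

end Preimages

/-! ### Vertices and geodesic rays of the metric graph -/

theorem isometry_of_lipschitzWith_one {X : Type*} [PseudoMetricSpace X] {γ : ℝ≥0 → X}
    (hγ : LipschitzWith 1 γ) (hnat : ∀ n : ℕ, n ≤ dist (γ 0) (γ n)) : Isometry γ := by
  have dist_eq_sub {s t : ℝ≥0} (hst : s ≤ t) : dist s t = t - s := by
    rw [NNReal.dist_eq, abs_sub_comm, abs_of_nonneg (sub_nonneg.2 (NNReal.coe_le_coe.2 hst))]
  have dist_le {s t : ℝ≥0} (hst : s ≤ t) : dist (γ s) (γ t) ≤ t - s := by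
    simpa [dist_eq_sub hst] using hγ.dist_le_mul s t
  refine Isometry.of_dist_eq fun s t => ?_
  wlog hst : s ≤ t generalizing s t
  · rw [dist_comm, this t s (le_of_not_ge hst), dist_comm]
  obtain ⟨n, hn⟩ := exists_nat_ge t
  rw [dist_eq_sub hst]
  refine le_antisymm (dist_le hst) ?_
  have h₀ := dist_le (zero_le (a := s))
  have h₁ := dist_le hn
  rw [NNReal.coe_zero] at h₀
  rw [NNReal.coe_natCast] at h₁
  linarith [hnat n, dist_triangle4 (γ 0) (γ s) (γ t) (γ n)]

namespace MetricGraph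

variable {V : Type*} {G : SimpleGraph V} (hG : G.Connected)

/-- A vertex, as a point of the metric graph. -/
noncomputable def vertex (v : V) : MetricGraph G hG :=
  SeparationQuotient.mk ⟨v, v, 0, le_rfl, zero_le_one, Or.inr ⟨rfl, rfl⟩⟩

theorem dist_vertex (u v : V) : dist (vertex hG u) (vertex hG v) = G.dist u v := by
  set p : V → MetricGraphRep G hG := fun w => ⟨w, w, 0, le_rfl, zero_le_one, Or.inr ⟨rfl, rfl⟩⟩
  change (p u).pathDist (p v) = _
  apply le_antisymm
  · simpa [p, MetricGraphRep.vert, MetricGraphRep.off] using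
      (p u).pathDist_le_through (p v) false false
  · rcases (p u).pathDist_cases (p v) with ⟨huv, -, h⟩ | ⟨huv, -, h⟩ | ⟨i, j, h⟩
    · rw [h, show u = v from huv]; simp
    · rw [h, show u = v from huv]; simp
    · rw [h]
      cases i <;> cases j <;> simp only [p, MetricGraphRep.vert, MetricGraphRep.off] <;> linarith

theorem exists_dist_vertex_le_one (x : MetricGraph G hG) : ∃ v, dist x (vertex hG v) ≤ 1 := by
  obtain ⟨p, rfl⟩ := SeparationQuotient.surjective_mk x
  refine ⟨p.src, (MetricGraphRep.pathDist_le_through _ _ false false).trans ?_⟩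
  simpa [MetricGraphRep.vert, MetricGraphRep.off] using p.pos_le_one

/-- The path in the metric graph that runs through the edges of a sequence of vertices at unit
speed. -/
noncomputable def unitSpeedPath {f : ℕ → V} (hf : ∀ n, G.Adj (f n) (f (n + 1))) (t : ℝ≥0) :
    MetricGraph G hG :=
  SeparationQuotient.mk ⟨f ⌊(t : ℝ)⌋₊, f (⌊(t : ℝ)⌋₊ + 1), t - ⌊(t : ℝ)⌋₊,
    sub_nonneg.2 (Nat.floor_le t.coe_nonneg),
    sub_le_iff_le_add'.2 (Nat.lt_floor_add_one _).le, Or.inl (hf _)⟩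

section UnitSpeedPath

variable {f : ℕ → V} (hf : ∀ n, G.Adj (f n) (f (n + 1)))

theorem dist_unitSpeedPath_vertex_floor (t : ℝ≥0) :
    dist (unitSpeedPath hG hf t) (vertex hG (f ⌊(t : ℝ)⌋₊)) ≤ t - ⌊(t : ℝ)⌋₊ :=
  (MetricGraphRep.pathDist_le_through _ _ false false).trans_eq
    (by simp [MetricGraphRep.vert, MetricGraphRep.off])

theorem dist_unitSpeedPath_vertex_floor_add_one (t : ℝ≥0) :
    dist (unitSpeedPath hG hf t) (vertex hG (f (⌊(t : ℝ)⌋₊ + 1))) ≤ ⌊(t : ℝ)⌋₊ + 1 - t :=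
  (MetricGraphRep.pathDist_le_through _ _ true false).trans_eq
    (by simp [MetricGraphRep.vert, MetricGraphRep.off]; ring)

theorem unitSpeedPath_natCast (n : ℕ) : unitSpeedPath hG hf n = vertex hG (f n) := by
  simpa [dist_le_zero] using dist_unitSpeedPath_vertex_floor hG hf n

theorem dist_unitSpeedPath_of_floor_eq {s t : ℝ≥0} (h : ⌊(s : ℝ)⌋₊ = ⌊(t : ℝ)⌋₊) :
    dist (unitSpeedPath hG hf s) (unitSpeedPath hG hf t) = dist s t := by
  refine (if_pos ⟨?_, ?_⟩ : MetricGraphRep.pathDist _ _ = _).trans ?_ <;>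
    simp [h, NNReal.dist_eq]

theorem dist_vertex_le_sub (hf : ∀ n, G.Adj (f n) (f (n + 1))) {m n : ℕ} (hmn : m ≤ n) :
    dist (vertex hG (f m)) (vertex hG (f n)) ≤ n - m := by
  have hsucc (k : ℕ) : dist (vertex hG (f k)) (vertex hG (f (k + 1))) ≤ 1 := by
    rw [dist_vertex, SimpleGraph.dist_eq_one_iff_adj.2 (hf k), Nat.cast_one]
  simpa [Nat.cast_sub hmn] using
    dist_le_Ico_sum_of_dist_le (f := fun k => vertex hG (f k)) (d := fun _ => (1 : ℝ)) hmn
      fun {k} _ _ => hsucc k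

theorem lipschitzWith_unitSpeedPath : LipschitzWith 1 (unitSpeedPath hG hf) := by
  refine LipschitzWith.mk_one fun s t => ?_
  wlog hst : s ≤ t generalizing s t
  · rw [dist_comm, dist_comm s]
    exact this t s (le_of_not_ge hst)
  have hst' : (s : ℝ) ≤ t := hst
  rcases (Nat.floor_mono hst').eq_or_lt with heq | hlt
  · exact (dist_unitSpeedPath_of_floor_eq hG hf heq).le
  have hs := dist_unitSpeedPath_vertex_floor_add_one hG hf s
  have ht := dist_unitSpeedPath_vertex_floor hG hf t
  have hmid := dist_vertex_le_sub hG hf (Nat.succ_le_of_lt hlt)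
  have := dist_triangle4_right (unitSpeedPath hG hf s) (unitSpeedPath hG hf t)
    (vertex hG (f (⌊(s : ℝ)⌋₊ + 1))) (vertex hG (f ⌊(t : ℝ)⌋₊))
  rw [NNReal.dist_eq, abs_sub_comm, abs_of_nonneg (sub_nonneg.2 hst')]
  push_cast at hmid
  linarith

end UnitSpeedPath

variable [MetricSpace V] [IsGraphMetric G]

theorem isometry_vertex : Isometry (vertex hG) :=
  Isometry.of_dist_eq fun u v => by rw [dist_vertex, IsGraphMetric.dist_eq (G := G)]

theorem exists_isometry_natCast_eq_vertex {f : ℕ → V} (hf : Isometry f) :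
    ∃ γ : ℝ≥0 → MetricGraph G hG, Isometry γ ∧ ∀ n : ℕ, γ n = vertex hG (f n) := by
  have hadj (n : ℕ) : G.Adj (f n) (f (n + 1)) := by
    rw [← dist_eq_one_iff_adj G, hf.dist_eq, Nat.dist_eq]
    simp
  refine ⟨unitSpeedPath hG hadj, isometry_of_lipschitzWith_one
    (lipschitzWith_unitSpeedPath hG hadj) fun n => ?_, unitSpeedPath_natCast hG hadj⟩
  have h₀ := unitSpeedPath_natCast hG hadj 0
  rw [Nat.cast_zero] at h₀
  rw [h₀, unitSpeedPath_natCast, (isometry_vertex hG).dist_eq, dist_ray_zero hf]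

theorem hasPole_of_forall_exists_ray {o : V} {C : ℝ}
    (hray : ∀ x, ∃ f : ℕ → V, f 0 = o ∧ Isometry f ∧ ∃ n, dist x (f n) ≤ C) :
    HasPole (MetricGraph G hG) := by
  have hC : 0 ≤ C := by
    obtain ⟨f, -, -, n, hn⟩ := hray o
    exact dist_nonneg.trans hn
  refine ⟨vertex hG o, C + 2, by positivity, fun x => ?_⟩
  obtain ⟨v, hv⟩ := exists_dist_vertex_le_one hG x
  obtain ⟨f, rfl, hf, n, hn⟩ := hray v
  obtain ⟨γ, hγ, hγf⟩ := exists_isometry_natCast_eq_vertex hG hf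
  refine ⟨γ, hγ, by simpa using hγf 0, n, ?_⟩
  rw [← (isometry_vertex hG).dist_eq, ← hγf] at hn
  linarith [dist_triangle x (vertex hG v) (γ n)]

end MetricGraph

section Isoperimetry

variable {V : Type*} [MetricSpace V] {G : SimpleGraph V} [IsGraphMetric G] {D : ℕ} {δ : ℝ}

theorem exists_hasIsoperimetry_iff (hG : G.Connected) (hδ : DeltaInequality V δ)
    (hD : DegreeLT G D) (hD₁ : 1 < D) (o : V) :
    (∃ h, 0 < h ∧ HasIsoperimetry G h) ↔
      HasPole (MetricGraph G hG) ∧ IsUniformlyBranching V o := by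
  classical
  constructor
  · rintro ⟨h, hh, hiso⟩
    have : Nonempty V := ⟨o⟩
    obtain ⟨T, hT⟩ := exists_infinite_directions hδ hD hD₁ hh hiso 2
    constructor
    · refine MetricGraph.hasPole_of_forall_exists_ray hG fun x =>
        exists_ray_dist_le hδ hD.finite_neighborSet (T := T) (o := o) ?_
      simpa using hT x {o} (by simp)
    · refine isUniformlyBranching_of_infinite_directions (T := T) hδ hD.finite_neighborSet
        fun p z => ?_
      simpa using hT p {o, z} Finset.card_le_two
  · rintro ⟨hpole, hbranch⟩
    obtain ⟨v, hv⟩ := hpole.exists_isVisual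
    have hvisual : IsVisual V o :=
      (hv.change_base (MetricGraph.vertex hG o)).of_isometry (MetricGraph.isometry_vertex hG)
        (MetricGraph.exists_dist_vertex_le_one hG)
    exact exists_hasIsoperimetry_of_isVisual_of_isUniformlyBranching hδ hD (by omega) hvisual
      hbranch

end Isoperimetry

theorem mainTheorem3 {V : Type*} (G : SimpleGraph V) (hG : G.Connected)
    (hunif : IsUniformGraph G) (hhyp : IsGromovHyperbolic (MetricGraph G hG)) :
    0 < cheegerConstant G ↔
      Infinite V ∧ HasPole (MetricGraph G hG) ∧
        ∃ d : MetricSpace (GromovBoundary (MetricGraph G hG) hhyp),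
          IsVisualMetric d ∧
            @IsUniformlyPerfect (GromovBoundary (MetricGraph G hG) hhyp) d := by
  let := graphMetricSpace hG
  have := isGraphMetric_graphMetricSpace hG
  have := hG.nonempty
  obtain ⟨D, hD₁, hD⟩ := hunif.exists_degreeLT
  obtain ⟨δ, hδ⟩ := hhyp.exists_deltaInequality
  have hvertex := MetricGraph.isometry_vertex hG
  let o : V := Classical.arbitrary V
  have hiso := exists_hasIsoperimetry_iff hG (hδ.of_isometry hvertex) hD hD₁ o
  have hbranch := isUniformlyBranching_iff_of_isometry hvertex
    (MetricGraph.exists_dist_vertex_le_one hG) o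
  rw [cheegerConstant_pos_iff hD.finite_neighborSet]
  constructor
  · rintro ⟨h, hh, hh_iso⟩
    have : Nonempty (MetricGraph G hG) := ⟨MetricGraph.vertex hG o⟩
    obtain ⟨hpole, hV⟩ := hiso.1 ⟨h, hh, hh_iso⟩
    obtain ⟨d, hd⟩ := exists_isVisualMetric hhyp
    exact ⟨hh_iso.infinite hh, hpole, d, hd, hd.isUniformlyPerfect (hbranch.1 hV)⟩
  · rintro ⟨-, hpole, d, hd, hperfect⟩
    exact hiso.2 ⟨hpole, hbranch.2 (hd.isUniformlyBranching hperfect _)⟩
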